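/- **Proposition (space-reflection symmetry).** Let $d\in\mathbb N$, let $\Gamma\subset\mathbb R^d$ be the lattice generated by a basis $\gamma_1,\dots,\gamma_d$ of $\mathbb R^d$, $\Gamma^*$ its dual lattice with generators $\gamma_j^*$, $\gamma_j^*\cdot\gamma_l=2\pi\delta_{jl}$, and let $Y=\{\sum_l\zeta_l\gamma_l:\zeta_l\in[-\frac12,\frac12]\}$ and $Y^*=\{\sum_l\zeta_l\gamma^*_l:\zeta_l\in[-\frac12,\frac12]\}$ be the centered fundamental domains. Let $\mathcal H_{\rm f}=L^2(Y)=L^2(\mathbb R^d/\Gamma)$, let $\mathcal Z:L^2(\mathbb R^d)\to L^2(Y^*;\mathcal H_{\rm f})$, $(\mathcal Z\psi)(k,y)=\sum_{\gamma\in\Gamma}e^{-i(y+\gamma)\cdot k}\psi(y+\gamma)$, be the Bloch-Floquet-Zak transform, and let $(\mathscr R\psi)(x)=\psi(-x)$ on $L^2(\mathbb R^d)$ and $(\mathscr R_{\rm f}u)(y)=u(-y)$ on $\mathcal H_{\rm f}$ be the space reflections. Let $I\subseteq\mathbb R$ be a set of times with the unique differentiability property (for instance $I=\mathbb R$ or $I=[0,T]$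 with $T>0$). For every $t\in I$ let $H(t)$ be a self-adjoint operator on $L^2(\mathbb R^d)$ that commutes with $\mathscr R$ and such that $\mathcal ZH(t)\mathcal Z^{-1}$ is continuously fibered, i.e. $\mathcal ZH(t)\mathcal Z^{-1}=\int^{\oplus}_{Y^*}H(k,t)\,dk$ with self-adjoint operators $H(k,t)$, $k\in\mathbb R^d$, on $\mathcal H_{\rm f}$ that are equivariant, $H(k+\gamma^*,t)=e^{-iy\cdot\gamma^*}H(k,t)e^{iy\cdot\gamma^*}$ for $\gamma^*\in\Gamma^*$, and for which $k\mapsto(H(k,t)-i)^{-1}$ is norm continuous. Let $P(k,t)$, $k\in\mathbb R^d$, $t\in I$, be either (a) the spectral (Fermi) projector $P(k,t)=\mathbf 1_{(-\infty,E(t))}(H(k,t))$ for some $E:I\to\mathbb R$, or (b) the orthogonal projector onto $\ker(H(k,t)-E_m(k,t))$, where for every $t\in I$ the function $E_m(\cdot,t)$ is an isolated Bloch band: it is continuous on $\mathbb R^d$, $E_m(k,t)$ is an eigenvalue of $H(k,t)$ for every $k$, and $\inf_k\operatorname{dist}\big(E_m(k,t),\sigma(H(k,t))\setminus\{E_m(k,t)\}\big)>0$.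 Then for all $t\in I$ and $k\in\mathbb R^d$ $$P(k,t)=\mathscr R_{\rm f}\,P(-k,t)\,\mathscr R_{\rm f},$$ and the piezocurvature $\Theta=(\Theta_1,\dots,\Theta_d)$, $\Theta_j=-i\operatorname{tr}\big(P\,[\partial_tP,\partial_{k_j}P]\big)$ (derivatives in operator norm; wherever it is defined), satisfies $$\Theta(-k,t)=-\Theta(k,t).$$ Consequently the (leading-order) piezoelectric current $-(2\pi)^{-d}\int_{Y^*}\Theta(k,t)\,dk$ vanishes for every $t\in I$. -/

import Mathlib

open MeasureTheory Set Filter Topology Complex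
open scoped ENNReal

namespace BlochFloquet

noncomputable section

/-! ### Unbounded operators on a Hilbert space -/

section Operators

universe u

variable {K : Type u} [NormedAddCommGroup K] [InnerProductSpace ℂ K] [CompleteSpace K]

/-- The bounded operator `R` is the resolvent `(A - z)⁻¹` of the (unbounded) operator `A`. -/
def IsResolvent (A : K →ₗ.[ℂ] K) (z : ℂ) (R : K →L[ℂ] K) : Prop :=
  (∀ v, (R v, v + z • R v) ∈ A.graph) ∧ ∀ u v, (u, v) ∈ A.graph → R (v - z • u) = u

/-- The spectrum of an (unbounded) operator: the set of all `z` for which `A - z` has no bounded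
everywhere defined two-sided inverse. -/
def opSpectrum (A : K →ₗ.[ℂ] K) : Set ℂ := {z | ¬ ∃ R, IsResolvent A z R}

/-- Projection-valued measures on the Borel sets of `ℝ`; countable additivity is understood in the
strong operator topology. -/
structure PVM (K : Type u) [NormedAddCommGroup K] [InnerProductSpace ℂ K] [CompleteSpace K] where
  toFun : Set ℝ → K →L[ℂ] K
  isStarProjection : ∀ S, MeasurableSet S → IsStarProjection (toFun S)
  map_univ : toFun univ = 1
  map_inter : ∀ S T, MeasurableSet S → MeasurableSet T → toFun (S ∩ T) = toFun S * toFun T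
  hasSum_iUnion : ∀ f : ℕ → Set ℝ, (∀ n, MeasurableSet (f n)) →
    Pairwise (Function.onFun Disjoint f) → ∀ u, HasSum (fun n => toFun (f n) u) (toFun (⋃ n, f n) u)

theorem PVM.inner_eq (F : PVM K) (u : K) {S : Set ℝ} (hS : MeasurableSet S) :
    inner ℂ u (F.toFun S u) = ((‖F.toFun S u‖ ^ 2 : ℝ) : ℂ) := by
  have h := F.isStarProjection S hS
  have h2 : F.toFun S (F.toFun S u) = F.toFun S u := by
    have := congrArg (fun T : K →L[ℂ] K => T u) h.isIdempotentElem.eq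
    simpa using this
  have h3 : ContinuousLinearMap.adjoint (F.toFun S) = F.toFun S := h.isSelfAdjoint
  have h4 := ContinuousLinearMap.adjoint_inner_right (F.toFun S) u (F.toFun S u)
  rw [h3, h2, inner_self_eq_norm_sq_to_K] at h4
  rw [h4]
  push_cast
  rfl

/-- The scalar spectral measure `S ↦ ⟨u, F(S) u⟩ = ‖F(S) u‖ ^ 2` of a projection-valued measure. -/
def PVM.scalar (F : PVM K) (u : K) : Measure ℝ :=
  Measure.ofMeasurable (fun S _ => ENNReal.ofReal (‖F.toFun S u‖ ^ 2))
    (by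
      have h := F.hasSum_iUnion (fun _ => ∅) (fun _ => MeasurableSet.empty)
        (fun _ _ _ => by simp [Function.onFun]) u
      have h0 : F.toFun ∅ u = 0 :=
        tendsto_nhds_unique tendsto_const_nhds h.summable.tendsto_atTop_zero
      simp [h0])
    (by
      intro f hf hd
      have h := (F.hasSum_iUnion f hf hd u).mapL (innerSL ℂ u)
      simp only [innerSL_apply_apply] at h
      rw [F.inner_eq u (MeasurableSet.iUnion hf)] at h
      simp only [F.inner_eq u (hf _)] at h
      have h' := Complex.hasSum_ofReal.1 h
      rw [← h'.tsum_eq, ENNReal.ofReal_tsum_of_nonneg (fun n => by positivity) h'.summable])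

/-- `A = ∫ x dF(x)`: the domain of `A` consists of all `u` with `∫ x² d⟨u, F(x) u⟩ < ∞`, and
`⟨u, A u⟩ = ∫ x d⟨u, F(x) u⟩` for every `u` in it (by polarization this determines `A`). -/
def IsSpectralMeasure (A : K →ₗ.[ℂ] K) (F : PVM K) : Prop :=
  (∀ u, u ∈ A.domain ↔ ∫⁻ x, ENNReal.ofReal (x ^ 2) ∂(F.scalar u) < ∞) ∧
  ∀ u : A.domain, inner ℂ (u : K) (A u) = ((∫ x, x ∂(F.scalar (u : K)) : ℝ) : ℂ)

/-- `P` is the spectral projection `1_S(A)` of the self-adjoint operator `A`. -/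
def IsSpectralProjection (A : K →ₗ.[ℂ] K) (S : Set ℝ) (P : K →L[ℂ] K) : Prop :=
  ∃ F : PVM K, IsSpectralMeasure A F ∧ P = F.toFun S

/-- `P` is the orthogonal projection onto the eigenspace `ker (A - e)`. -/
def IsEigenprojection (A : K →ₗ.[ℂ] K) (e : ℝ) (P : K →L[ℂ] K) : Prop :=
  IsStarProjection P ∧ ∀ u, P u = u ↔ (u, (e : ℂ) • u) ∈ A.graph

/-- The bounded operator `A` has trace `τ`: its diagonal sum converges unconditionally to `τ` in
every orthonormal basis. Such a `τ` exists exactly for the trace class operators. -/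
def HasTrace (A : K →L[ℂ] K) (τ : ℂ) : Prop :=
  ∀ (ι : Type u) (b : HilbertBasis ι ℂ K), HasSum (fun i => inner ℂ (b i) (A (b i))) τ

open Classical in
/-- The trace of a trace class operator (`0` if the operator is not trace class). -/
def trace (A : K →L[ℂ] K) : ℂ := if h : ∃ τ, HasTrace A τ then h.choose else 0

end Operators

/-! ### Lattices, function spaces, space reflection -/

variable {d : ℕ}

/-- The position space (and the momentum space). -/
abbrev Space (d : ℕ) := EuclideanSpace ℝ (Fin d)

/-- The point with integer coordinates `n` of the lattice generated by `v`. -/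
def latticePoint (v : Fin d → Space d) (n : Fin d → ℤ) : Space d := ∑ l, (n l : ℝ) • v l

/-- The centered fundamental domain `{∑ ζ_l v_l : ζ_l ∈ [-1/2, 1/2]}`. -/
def cell (v : Fin d → Space d) : Set (Space d) :=
  {x | ∃ ζ : Fin d → ℝ, (∀ l, ζ l ∈ Icc (-(1 / 2) : ℝ) (1 / 2)) ∧ x = ∑ l, ζ l • v l}

/-- The generators `γ*_j` of the dual lattice, `⟨γ*_j, γ_l⟩ = 2π δ_{jl}`. -/
def dualGen (γ : Module.Basis (Fin d) ℝ (Space d)) (j : Fin d) : Space d :=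
  (2 * Real.pi) • (InnerProductSpace.toDual ℝ (Space d)).symm
    (LinearMap.toContinuousLinearMap (γ.coord j))

theorem inner_dualGen (γ : Module.Basis (Fin d) ℝ (Space d)) (j l : Fin d) :
    inner ℝ (dualGen γ j) (γ l) = if j = l then 2 * Real.pi else 0 := by
  simp [dualGen, inner_smul_left, Finsupp.single_apply, eq_comm]

/-- The first Brillouin zone `Y*`. -/
def brillouin (γ : Module.Basis (Fin d) ℝ (Space d)) : Set (Space d) := cell (dualGen γ)

/-- `L²(ℝ^d)`. -/
abbrev L2Space (d : ℕ) := Lp ℂ 2 (volume : Measure (Space d))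

/-- The fibre space `L²(Y)`, that is, `L²` of the torus `ℝ^d / Γ`. -/
abbrev Fiber (γ : Module.Basis (Fin d) ℝ (Space d)) :=
  Lp ℂ 2 ((volume : Measure (Space d)).restrict (cell γ))

theorem neg_preimage_cell (v : Fin d → Space d) : (fun x : Space d => -x) ⁻¹' cell v = cell v := by
  ext x
  constructor
  · rintro ⟨ζ, hζ, h⟩
    refine ⟨fun l => -ζ l, fun l => ⟨by linarith [(hζ l).2], by linarith [(hζ l).1]⟩, ?_⟩
    simp only [neg_smul, Finset.sum_neg_distrib, ← h, neg_neg]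
  · rintro ⟨ζ, hζ, h⟩
    refine ⟨fun l => -ζ l, fun l => ⟨by linarith [(hζ l).2], by linarith [(hζ l).1]⟩, ?_⟩
    simp only [neg_smul, Finset.sum_neg_distrib, ← h]

theorem measurePreserving_neg_cell (v : Fin d → Space d) :
    MeasurePreserving (fun x : Space d => -x) (volume.restrict (cell v))
      (volume.restrict (cell v)) := by
  have h := (Measure.measurePreserving_neg (volume : Measure (Space d))).restrict_preimage_emb
    (MeasurableEquiv.neg (Space d)).measurableEmbedding (cell v)
  have h2 : (Neg.neg ⁻¹' cell v : Set (Space d)) = cell v := neg_preimage_cell v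
  rwa [h2] at h

/-- Space reflection `(R ψ)(x) = ψ(-x)` in `L²(ℝ^d)`. -/
def reflection (d : ℕ) : L2Space d →L[ℂ] L2Space d :=
  (Lp.compMeasurePreservingₗᵢ ℂ (fun x : Space d => -x)
    (Measure.measurePreserving_neg volume)).toContinuousLinearMap

/-- Space reflection `(R_f u)(y) = u(-y)` in the fibre space. -/
def fiberReflection (γ : Module.Basis (Fin d) ℝ (Space d)) : Fiber γ →L[ℂ] Fiber γ :=
  (Lp.compMeasurePreservingₗᵢ ℂ (fun x : Space d => -x)
    (measurePreserving_neg_cell γ)).toContinuousLinearMap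

/-- The (unbounded) operator `A` commutes with the space reflection. -/
def CommutesWithReflection (A : L2Space d →ₗ.[ℂ] L2Space d) : Prop :=
  ∀ ψ φ, (ψ, φ) ∈ A.graph → (reflection d ψ, reflection d φ) ∈ A.graph

/-! ### The Bloch-Floquet-Zak transform and fibred operators -/

theorem memLp_phase {μ : Measure (Space d)} {f : Space d → ℂ} (hf : MemLp f 2 μ) (a k : Space d) :
    MemLp (fun y => cexp (-(I * (inner ℝ (y + a) k : ℝ))) * f y) 2 μ := by
  refine hf.of_le (AEStronglyMeasurable.mul (Continuous.aestronglyMeasurable (by fun_prop)) hf.1)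
    (Eventually.of_forall fun y => ?_)
  rw [norm_mul, ← mul_neg, mul_comm I, ← ofReal_neg, norm_exp_ofReal_mul_I, one_mul]

theorem memLp_translate (γ : Module.Basis (Fin d) ℝ (Space d)) (ψ : L2Space d) (a : Space d) :
    MemLp (fun y => ψ (y + a)) 2 ((volume : Measure (Space d)).restrict (cell γ)) :=
  ((Lp.memLp ψ).comp_measurePreserving (measurePreserving_add_right volume a)).restrict _

/-- Multiplication by `y ↦ exp (-i y·κ)` in the fibre space. -/
def phase (γ : Module.Basis (Fin d) ℝ (Space d)) (κ : Space d) (u : Fiber γ) : Fiber γ :=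
  (memLp_phase (Lp.memLp u) 0 κ).toLp _

/-- The term `y ↦ exp (-i (y + a)·k) ψ(y + a)` of the Bloch-Floquet-Zak transform, for the lattice
vector `a` with coordinates `n`. -/
def zakTerm (γ : Module.Basis (Fin d) ℝ (Space d)) (ψ : L2Space d) (n : Fin d → ℤ) (k : Space d) :
    Fiber γ :=
  (memLp_phase (memLp_translate γ ψ (latticePoint γ n)) (latticePoint γ n) k).toLp _

/-- `Ψ` is (a representative of) the Bloch-Floquet-Zak transform
`(Z ψ)(k, y) = ∑_{a ∈ Γ} exp (-i (y + a)·k) ψ(y + a)` of `ψ`, where the series converges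
(unconditionally) in `L²(Y*; L²(Y))`. -/
def IsZakTransform (γ : Module.Basis (Fin d) ℝ (Space d)) (ψ : L2Space d)
    (Ψ : Space d → Fiber γ) : Prop :=
  AEStronglyMeasurable Ψ (volume.restrict (brillouin γ)) ∧
  Tendsto (fun s : Finset (Fin d → ℤ) =>
    eLpNorm (fun k => Ψ k - ∑ n ∈ s, zakTerm γ ψ n k) 2 (volume.restrict (brillouin γ)))
    atTop (𝓝 0)

/-- `Z H Z⁻¹` is the direct integral over `Y*` of the self-adjoint operators `h k`, and this
fibration is continuous: the family `h`, extended to all `k ∈ ℝ^d` in the `τ`-equivariant way, is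
continuous in the norm resolvent sense. The direct integral is expressed through graphs:
`ψ ∈ D(H)` and `H ψ = φ` if and only if `(Z ψ)(k) ∈ D(h k)` and `h k (Z ψ)(k) = (Z φ)(k)` for
almost every `k ∈ Y*`. Equivariance reads `h (k + κ) = τ h k τ⁻¹` for `κ` in the dual lattice, with
`τ` the multiplication by `exp (-i y·κ)`. -/
structure IsContinuouslyFibered (γ : Module.Basis (Fin d) ℝ (Space d))
    (H : L2Space d →ₗ.[ℂ] L2Space d) (h : Space d → Fiber γ →ₗ.[ℂ] Fiber γ) : Prop where
  selfAdjoint : ∀ k, IsSelfAdjoint (h k)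
  directIntegral : ∀ ψ φ Ψ Φ, IsZakTransform γ ψ Ψ → IsZakTransform γ φ Φ →
    ((ψ, φ) ∈ H.graph ↔ ∀ᵐ k ∂(volume.restrict (brillouin γ)), (Ψ k, Φ k) ∈ (h k).graph)
  equivariant : ∀ k n u v, (u, v) ∈ (h k).graph →
    (phase γ (latticePoint (dualGen γ) n) u, phase γ (latticePoint (dualGen γ) n) v) ∈
      (h (k + latticePoint (dualGen γ) n)).graph
  continuous : ∃ res : Space d → Fiber γ →L[ℂ] Fiber γ,
    Continuous res ∧ ∀ k, IsResolvent (h k) I (res k)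

/-- `e` is an isolated Bloch band of the fibred operator: a continuous family of eigenvalues which
is separated from the rest of the spectrum by a gap, uniformly in `k`. -/
structure IsIsolatedBand {γ : Module.Basis (Fin d) ℝ (Space d)}
    (h : Space d → Fiber γ →ₗ.[ℂ] Fiber γ) (e : Space d → ℝ) : Prop where
  continuous : Continuous e
  eigenvalue : ∀ k, ∃ u : Fiber γ, u ≠ 0 ∧ (u, (e k : ℂ) • u) ∈ (h k).graph
  gap : ∃ g > 0, ∀ k, ∀ x : ℝ, (x : ℂ) ∈ opSpectrum (h k) → x ≠ e k → g ≤ |x - e k|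

/-! ### Piezocurvature and piezoelectric current -/

/-- The piezocurvature `Θ_j = -i tr (P [∂_t P, ∂_{k_j} P])`, `j = 1, …, d`; the time derivative is
taken within the time set `J`. -/
def piezocurvature {γ : Module.Basis (Fin d) ℝ (Space d)} (J : Set ℝ)
    (P : Space d → ℝ → Fiber γ →L[ℂ] Fiber γ) (k : Space d) (t : ℝ) : Fin d → ℂ := fun j =>
  let Pt := derivWithin (fun s => P k s) J t;
  let Pj := lineDeriv ℝ (fun q => P q t) k (EuclideanSpace.single j 1);
  -I * trace (P k t * (Pt * Pj - Pj * Pt))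

/-- The piezoelectric current `-(2π)^{-d} ∫_{Y*} Θ(k, t) dk`. -/
def piezoCurrent {γ : Module.Basis (Fin d) ℝ (Space d)} (J : Set ℝ)
    (P : Space d → ℝ → Fiber γ →L[ℂ] Fiber γ) (t : ℝ) : Fin d → ℂ :=
  -(((2 * Real.pi) ^ d)⁻¹ : ℝ) • ∫ k in brillouin γ, piezocurvature J P k t

end

end BlochFloquet

open BlochFloquet

namespace BlochFloquet

noncomputable section

section Operators

universe u

variable {K : Type u} [NormedAddCommGroup K] [InnerProductSpace ℂ K] [CompleteSpace K]

/-! ### Self-adjoint operators and their resolvents -/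

/-! The core is that the fibre reflection carries the graph of the fibre operator at `k` onto the
graph at `-k` (`IsContinuouslyFibered.reflection_mem_graph`). To get it, solve `(H - i) φ = w` with
`w` supported in one cell. The Zak transform of `w` is then the explicit continuous function `k ↦
exp (-i y·k) u`, and `reflection` acts on transforms as `Ψ(k) ↦ R_f Ψ(-k)`. Comparing the fibres of
`φ` and of its reflection gives `R_f res(-k) = res(k) R_f` on these vectors for almost every `k` in
the Brillouin zone. Norm continuity of the resolvents makes this hold everywhere in the zone, and
equivariance extends it to all quasi-momenta.

In case (a), an intertwiner of two self-adjoint operators intertwines their spectral projections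
(`IsSpectralMeasure.mul_map_Iio_eq`). This follows directly from the quadratic-form description of
spectral measures, through an estimate of Sylvester type on separated spectral subspaces; since the
two measures are arbitrary, no choice of spectral measure matters. In case (b), `e(-k)` is also an
eigenvalue at `k`, so the gap and connectedness force the band to be even (`isolatedBand_even`), and
the two projections have the same range.

Conjugation by `R_f` is a continuous linear involution that preserves the trace. It commutes with
the time derivative, while `k ↦ -k` gives the momentum derivative a sign; the curvature is therefore
odd, and its integral over the symmetric cell vanishes. The default values of derivative, trace and
integral obey the same symmetries, so no regularity of `P` is needed. -/

theorem inner_graph_symm {A : K →ₗ.[ℂ] K} (hA : IsSelfAdjoint A) {u v u' v' : K}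
    (h : (u, v) ∈ A.graph) (h' : (u', v') ∈ A.graph) : inner ℂ v u' = inner ℂ u v' := by
  obtain ⟨x, rfl, rfl⟩ := (LinearPMap.mem_graph_iff A).1 h
  obtain ⟨y, rfl, rfl⟩ := (LinearPMap.mem_graph_iff A).1 h'
  have := LinearPMap.adjoint_isFormalAdjoint hA.dense_domain
  rw [LinearPMap.isSelfAdjoint_def.1 hA] at this
  exact this x y

/-- The hypothesis says that `(u, v)` is in the graph of the adjoint, which is `A` itself. -/
theorem mem_graph_of_forall_inner {A : K →ₗ.[ℂ] K} (hA : IsSelfAdjoint A) {u v : K}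
    (h : ∀ u' v', (u', v') ∈ A.graph → inner ℂ v u' = inner ℂ u v') : (u, v) ∈ A.graph := by
  have h1 : ∀ x : A.domain, inner ℂ v (x : K) = inner ℂ u (A x) :=
    fun x => h _ _ (LinearPMap.mem_graph A x)
  have h2 : u ∈ A.adjoint.domain := LinearPMap.mem_adjoint_domain_of_exists u ⟨v, h1⟩
  have h3 := LinearPMap.adjoint_apply_eq hA.dense_domain ⟨u, h2⟩ h1
  have h4 := LinearPMap.mem_graph A.adjoint ⟨u, h2⟩
  rw [h3] at h4
  change (u, v) ∈ A.adjoint.graph at h4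
  rwa [LinearPMap.isSelfAdjoint_def.1 hA] at h4

/-- Symmetry makes `⟨v, u⟩` real, so the cross term has no real part. This is what makes `A - i`
bounded below in the graph norm. -/
theorem norm_sq_sub_I_smul {A : K →ₗ.[ℂ] K} (hA : IsSelfAdjoint A) {u v : K}
    (h : (u, v) ∈ A.graph) : ‖v - I • u‖ ^ 2 = ‖v‖ ^ 2 + ‖u‖ ^ 2 := by
  have h1 := inner_graph_symm hA h h
  rw [@norm_sub_sq ℂ, inner_smul_right, norm_smul, norm_I, one_mul]
  have h2 : (inner ℂ v u : ℂ).im = 0 := by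
    have h3 := congrArg Complex.im (inner_conj_symm (𝕜 := ℂ) v u)
    rw [← h1, conj_im] at h3
    linarith
  simp [h2]

/-- For a self-adjoint operator `A` the operator `A - i` is onto. -/
theorem exists_graph_sub_I {A : K →ₗ.[ℂ] K} (hA : IsSelfAdjoint A) (w : K) :
    ∃ u, (u, w + I • u) ∈ A.graph := by
  -- Viewed on the closed graph, `A - i` is a bounded map that is bounded below, so its range is
  -- closed.
  let L : K × K →L[ℂ] K := ContinuousLinearMap.snd ℂ K K - I • ContinuousLinearMap.fst ℂ K K
  let M : A.graph →L[ℂ] K := L.comp A.graph.subtypeL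
  have hM : ∀ p : A.graph, M p = (p : K × K).2 - I • (p : K × K).1 := fun p => rfl
  have hcl : IsClosed (A.graph : Set (K × K)) := hA.isClosed
  have : CompleteSpace A.graph := hcl.completeSpace_coe
  have hanti : AntilipschitzWith 1 M := by
    refine AddMonoidHomClass.antilipschitz_of_bound M fun p => ?_
    have h1 := norm_sq_sub_I_smul hA (u := (p : K × K).1) (v := (p : K × K).2) p.2
    rw [← hM] at h1
    have h2 : ‖(p : K × K).1‖ ≤ ‖M p‖ := by
      apply le_of_sq_le_sq _ (norm_nonneg _); nlinarith [sq_nonneg ‖(p : K × K).2‖]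
    have h3 : ‖(p : K × K).2‖ ≤ ‖M p‖ := by
      apply le_of_sq_le_sq _ (norm_nonneg _); nlinarith [sq_nonneg ‖(p : K × K).1‖]
    simpa [Prod.norm_def] using ⟨h2, h3⟩
  have hrc : IsClosed (LinearMap.range (M : A.graph →ₗ[ℂ] K) : Set K) := by
    have := hanti.isClosed_range M.uniformContinuous
    convert this using 1
    exact LinearMap.coe_range _
  have : CompleteSpace (LinearMap.range (M : A.graph →ₗ[ℂ] K)) := hrc.completeSpace_coe
  have htop : LinearMap.range (M : A.graph →ₗ[ℂ] K) = ⊤ := by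
    rw [← Submodule.orthogonal_eq_bot_iff, Submodule.eq_bot_iff]
    intro x hx
    rw [Submodule.mem_orthogonal'] at hx
    have h1 : ∀ u' v', (u', v') ∈ A.graph → inner ℂ x (v' - I • u') = 0 :=
      fun u' v' h => hx _ ⟨⟨(u', v'), h⟩, rfl⟩
    -- A vector orthogonal to the range is an eigenvector for `-i`; the norm identity then reads
    -- `4‖x‖² = 2‖x‖²`.
    have h2 : (x, (-I) • x) ∈ A.graph := by
      refine mem_graph_of_forall_inner hA fun u' v' h => ?_
      have := h1 u' v' h
      rw [inner_sub_right, inner_smul_right, sub_eq_zero] at this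
      rw [this, inner_smul_left]
      simp
    have h3 := norm_sq_sub_I_smul hA h2
    have h4 : (-I) • x - I • x = (-2 * I) • x := by module
    rw [h4, norm_smul, norm_smul] at h3
    simp at h3
    have h5 : ‖x‖ ^ 2 = 0 := by nlinarith [sq_nonneg ‖x‖]
    simpa using h5
  have hw : w ∈ LinearMap.range (M : A.graph →ₗ[ℂ] K) := htop ▸ Submodule.mem_top
  obtain ⟨⟨⟨u, v⟩, hp⟩, rfl⟩ := hw
  refine ⟨u, ?_⟩
  have : M ⟨(u, v), hp⟩ + I • u = v := by rw [hM]; simp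
  simpa [this] using hp

/-! ### Projection-valued measures -/

namespace PVM

variable (F : PVM K)

theorem map_empty : F.toFun ∅ = 0 := by
  ext u
  have h := F.hasSum_iUnion (fun _ => ∅) (fun _ => MeasurableSet.empty)
    (fun _ _ _ => by simp [Function.onFun]) u
  exact tendsto_nhds_unique tendsto_const_nhds h.summable.tendsto_atTop_zero

theorem map_apply_map {S : Set ℝ} (hS : MeasurableSet S) (u : K) :
    F.toFun S (F.toFun S u) = F.toFun S u :=
  congrArg (fun T : K →L[ℂ] K => T u) (F.isStarProjection S hS).isIdempotentElem.eq

theorem inner_map_left {S : Set ℝ} (hS : MeasurableSet S) (u v : K) :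
    inner ℂ (F.toFun S u) v = inner ℂ u (F.toFun S v) := by
  have h3 : ContinuousLinearMap.adjoint (F.toFun S) = F.toFun S :=
    (F.isStarProjection S hS).isSelfAdjoint
  conv_lhs => rw [← h3]
  exact ContinuousLinearMap.adjoint_inner_left _ _ _

theorem map_add_map_compl {S : Set ℝ} (hS : MeasurableSet S) (u : K) :
    F.toFun S u + F.toFun Sᶜ u = u := by
  -- Finite additivity is countable additivity for a sequence padded with empty sets.
  let f : ℕ → Set ℝ := fun n => if n = 0 then S else if n = 1 then Sᶜ else ∅
  have hf : ∀ n, MeasurableSet (f n) := by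
    intro n
    simp only [f]
    split_ifs <;> simp [hS, hS.compl]
  have hd : Pairwise (Function.onFun Disjoint f) := by
    intro m n hmn
    simp only [Function.onFun, f]
    split_ifs <;> simp_all [disjoint_compl_right, disjoint_compl_left]
  have hU : (⋃ n, f n) = univ := by
    refine eq_univ_of_forall fun x => mem_iUnion.2 ?_
    by_cases hx : x ∈ S
    · exact ⟨0, by simpa [f] using hx⟩
    · exact ⟨1, by simpa [f] using hx⟩
  have h1 := F.hasSum_iUnion f hf hd u
  rw [hU, F.map_univ] at h1
  have h2 : HasSum (fun n => F.toFun (f n) u) (∑ n ∈ ({0, 1} : Finset ℕ), F.toFun (f n) u) := by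
    refine hasSum_sum_of_ne_finset_zero fun n hn => ?_
    have : f n = ∅ := by simp at hn; simp [f, hn]
    simp [this, F.map_empty]
  have h3 := h2.unique h1
  simpa [f] using h3

theorem map_compl_apply {S : Set ℝ} (hS : MeasurableSet S) (u : K) :
    F.toFun Sᶜ u = u - F.toFun S u := by
  rw [eq_sub_iff_add_eq', F.map_add_map_compl hS]

theorem norm_map_apply_le {S : Set ℝ} (hS : MeasurableSet S) (u : K) : ‖F.toFun S u‖ ≤ ‖u‖ := by
  have h := (F.toFun S).le_opNorm u
  have h2 := (F.isStarProjection S hS).norm_le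
  nlinarith [norm_nonneg u]

theorem scalar_apply (u : K) {S : Set ℝ} (hS : MeasurableSet S) :
    F.scalar u S = ENNReal.ofReal (‖F.toFun S u‖ ^ 2) :=
  Measure.ofMeasurable_apply S hS

theorem scalar_univ (u : K) : F.scalar u univ = ENNReal.ofReal (‖u‖ ^ 2) := by
  rw [F.scalar_apply u MeasurableSet.univ, F.map_univ]; rfl

instance isFiniteMeasure_scalar (u : K) : IsFiniteMeasure (F.scalar u) :=
  ⟨by rw [F.scalar_univ]; exact ENNReal.ofReal_lt_top⟩

theorem scalar_map (u : K) {S : Set ℝ} (hS : MeasurableSet S) :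
    F.scalar (F.toFun S u) = (F.scalar u).restrict S := by
  ext T hT
  rw [Measure.restrict_apply hT, F.scalar_apply _ hT, F.scalar_apply _ (hT.inter hS),
    F.map_inter T S hT hS]
  rfl

/-- Spectral projections commute, so `F(S)u` and `F(S)v` stay in the range and the kernel of `F(T)`
and are orthogonal; Pythagoras does the rest. -/
theorem scalar_add {T : Set ℝ} (hT : MeasurableSet T) {u v : K} (hu : F.toFun T u = u)
    (hv : F.toFun T v = 0) : F.scalar (u + v) = F.scalar u + F.scalar v := by
  ext S hS
  have hcomm : F.toFun T (F.toFun S u) = F.toFun S u := by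
    have h1 : F.toFun T * F.toFun S = F.toFun S * F.toFun T := by
      rw [← F.map_inter T S hT hS, ← F.map_inter S T hS hT, inter_comm]
    have h2 := congrArg (fun B : K →L[ℂ] K => B u) h1
    simpa [hu] using h2
  have hcomm' : F.toFun T (F.toFun S v) = 0 := by
    have h1 : F.toFun T * F.toFun S = F.toFun S * F.toFun T := by
      rw [← F.map_inter T S hT hS, ← F.map_inter S T hS hT, inter_comm]
    have h2 := congrArg (fun B : K →L[ℂ] K => B v) h1
    simpa [hv] using h2
  have h0 : inner ℂ (F.toFun S u) (F.toFun S v) = 0 := by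
    rw [← hcomm, F.inner_map_left hT, hcomm', inner_zero_right]
  rw [Measure.add_apply, F.scalar_apply _ hS, F.scalar_apply _ hS, F.scalar_apply _ hS,
    ← ENNReal.ofReal_add (by positivity) (by positivity), map_add]
  congr 1
  have := norm_add_sq_eq_norm_sq_add_norm_sq_of_inner_eq_zero _ _ h0
  nlinarith

end PVM

/-! ### Spectral measures of a self-adjoint operator -/

namespace IsSpectralMeasure

variable {A : K →ₗ.[ℂ] K} {F : PVM K} (hF : IsSpectralMeasure A F)
include hF

theorem integrable_id {u v : K} (h : (u, v) ∈ A.graph) :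
    Integrable (fun x : ℝ => x) (F.scalar u) := by
  have h1 := (hF.1 u).1 (LinearPMap.mem_domain_of_mem_graph h)
  have h2 : MemLp (fun x : ℝ => x) 2 (F.scalar u) := by
    rw [memLp_two_iff_integrable_sq (by fun_prop)]
    refine ⟨by fun_prop, ?_⟩
    rw [hasFiniteIntegral_iff_ofReal (Eventually.of_forall fun x => sq_nonneg x)]
    exact h1
  exact h2.integrable (by norm_num)

theorem inner_eq_integral {u v : K} (h : (u, v) ∈ A.graph) :
    inner ℂ u v = ((∫ x, x ∂(F.scalar u) : ℝ) : ℂ) := by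
  obtain ⟨x, rfl, rfl⟩ := (LinearPMap.mem_graph_iff A).1 h
  exact hF.2 x

theorem inner_sub_eq_integral {u v : K} (h : (u, v) ∈ A.graph) (c : ℝ) :
    inner ℂ u (v - (c : ℂ) • u) = ((∫ x, (x - c) ∂(F.scalar u) : ℝ) : ℂ) := by
  rw [inner_sub_right, inner_smul_right, hF.inner_eq_integral h,
    integral_sub (hF.integrable_id h) (integrable_const c), integral_const, measureReal_def,
    F.scalar_univ, ENNReal.toReal_ofReal (by positivity), inner_self_eq_norm_sq_to_K]
  push_cast
  simp
  ring

theorem exists_graph_map {u v : K} (h : (u, v) ∈ A.graph) {T : Set ℝ} (hT : MeasurableSet T) :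
    ∃ w, (F.toFun T u, w) ∈ A.graph := by
  rw [← LinearPMap.mem_domain_iff, hF.1, F.scalar_map u hT]
  exact (setLIntegral_le_lintegral _ _).trans_lt
    ((hF.1 u).1 (LinearPMap.mem_domain_of_mem_graph h))

theorem exists_graph_of_bounded {S : Set ℝ} (hS : MeasurableSet S) {r : ℝ} (hr : ∀ x ∈ S, |x| ≤ r)
    {u : K} (hu : F.toFun S u = u) : ∃ v, (u, v) ∈ A.graph := by
  rw [← LinearPMap.mem_domain_iff, hF.1, ← hu, F.scalar_map u hS]
  calc ∫⁻ x in S, ENNReal.ofReal (x ^ 2) ∂(F.scalar u)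
      ≤ ∫⁻ _ in S, ENNReal.ofReal (r ^ 2) ∂(F.scalar u) := by
        refine setLIntegral_mono' hS fun x hx => ENNReal.ofReal_le_ofReal ?_
        exact sq_le_sq' (by linarith [neg_abs_le x, hr x hx]) (by linarith [le_abs_self x, hr x hx])
    _ < ∞ := by
        rw [setLIntegral_const]
        exact ENNReal.mul_lt_top ENNReal.ofReal_lt_top (measure_lt_top _ _)

/-- The spectral measure determines only the diagonal of the form. Since the scalar measures of `u`
and `u'` add, the cross terms in `⟨u + u', A(u + u')⟩` sum to zero; replacing `u'` by `i u'` makes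
their difference vanish too. -/
theorem inner_graph_eq_zero {T : Set ℝ} (hT : MeasurableSet T) {u v u' v' : K}
    (h : (u, v) ∈ A.graph) (h' : (u', v') ∈ A.graph) (hu : F.toFun T u = u)
    (hu' : F.toFun T u' = 0) : inner ℂ u v' = 0 ∧ inner ℂ u' v = 0 := by
  have key : ∀ p q, (p, q) ∈ A.graph → F.toFun T p = 0 → inner ℂ u q + inner ℂ p v = 0 := by
    intro p q hpq hp
    have h1 : (u + p, v + q) ∈ A.graph := A.graph.add_mem h hpq
    have h2 := hF.inner_eq_integral h1
    rw [F.scalar_add hT hu hp, integral_add_measure (hF.integrable_id h) (hF.integrable_id hpq),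
      ofReal_add, ← hF.inner_eq_integral h, ← hF.inner_eq_integral hpq] at h2
    simp only [inner_add_left, inner_add_right] at h2
    linear_combination h2
  have h1 := key u' v' h' hu'
  have h2 := key (I • u') (I • v') (A.graph.smul_mem I h') (by simp [hu'])
  rw [inner_smul_right, inner_smul_left, conj_I] at h2
  have h3 : inner ℂ u v' - inner ℂ u' v = 0 := by
    have : I * (inner ℂ u v' - inner ℂ u' v) = 0 := by linear_combination h2
    simpa using this
  exact ⟨by linear_combination (h1 + h3) / 2, by linear_combination (h1 - h3) / 2⟩

/-- The spectral projections leave the graph invariant. -/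
theorem map_mem_graph (hA : IsSelfAdjoint A) {u v : K} (h : (u, v) ∈ A.graph) {T : Set ℝ}
    (hT : MeasurableSet T) : (F.toFun T u, F.toFun T v) ∈ A.graph := by
  -- `A` maps the domain vectors in the range of `F(S)` back into that range: test `F(Sᶜ) q` against
  -- the dense domain, which `F(Sᶜ)` preserves.
  have key : ∀ S : Set ℝ, MeasurableSet S → ∀ p q, (p, q) ∈ A.graph → F.toFun S p = p →
      F.toFun S q = q := by
    intro S hS p q hpq hp
    have h1 : F.toFun Sᶜ q = 0 := by
      refine hA.dense_domain.eq_zero_of_inner_right ℂ fun x hx => ?_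
      obtain ⟨y, hy⟩ := LinearPMap.mem_domain_iff.1 hx
      obtain ⟨w, hw⟩ := hF.exists_graph_map hy hS.compl
      rw [← F.inner_map_left hS.compl]
      refine (hF.inner_graph_eq_zero hS hpq hw hp ?_).2
      rw [F.map_compl_apply hS, map_sub, F.map_apply_map hS, sub_self]
    rw [F.map_compl_apply hS, sub_eq_zero] at h1
    exact h1.symm
  obtain ⟨w, hw⟩ := hF.exists_graph_map h hT
  have h1 := key T hT _ _ hw (F.map_apply_map hT u)
  have h2 : (F.toFun Tᶜ u, v - w) ∈ A.graph := by
    rw [F.map_compl_apply hT]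
    exact A.graph.sub_mem h hw
  have h3 := key Tᶜ hT.compl _ _ h2 (F.map_apply_map hT.compl u)
  rw [F.map_compl_apply hT, map_sub, h1] at h3
  have h4 : F.toFun T v = w := by simpa using h3
  rwa [h4]

/-! ### Norm estimates on spectral subspaces -/

theorem abs_re_inner_sub_le {S : Set ℝ} (hS : MeasurableSet S) {c r : ℝ}
    (hr : ∀ x ∈ S, |x - c| ≤ r) {u v : K} (h : (u, v) ∈ A.graph) (hu : F.toFun S u = u) :
    |(inner ℂ u (v - (c : ℂ) • u)).re| ≤ r * ‖u‖ ^ 2 := by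
  rw [hF.inner_sub_eq_integral h, ofReal_re]
  have h1 : ∀ᵐ x ∂(F.scalar u), ‖x - c‖ ≤ r := by
    rw [← hu, F.scalar_map u hS, ae_restrict_iff' hS]
    exact Eventually.of_forall hr
  have h2 := norm_integral_le_of_norm_le_const h1
  rwa [measureReal_def, F.scalar_univ, ENNReal.toReal_ofReal (by positivity)] at h2

/-- The bound on the quadratic form of `A - c` becomes a norm bound by polarization, as for bounded
symmetric operators. The vector `z = (A - c)u` may be inserted in the form because it lies in the
same spectral subspace, which is contained in the domain as `S` is bounded. -/
theorem norm_sub_smul_le (hA : IsSelfAdjoint A) {S : Set ℝ} (hS : MeasurableSet S) {c r : ℝ}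
    (hr : ∀ x ∈ S, |x - c| ≤ r) {u v : K} (h : (u, v) ∈ A.graph) (hu : F.toFun S u = u) :
    ‖v - (c : ℂ) • u‖ ≤ r * ‖u‖ := by
  set z := v - (c : ℂ) • u with hz
  have hv : F.toFun S v = v := by
    have h1 := hF.map_mem_graph hA h hS
    rw [hu] at h1
    exact LinearPMap.mem_graph_snd_inj A h1 h rfl
  have hzS : F.toFun S z = z := by rw [hz, map_sub, map_smul, hu, hv]
  have hSb : ∀ x ∈ S, |x| ≤ r + |c| := fun x hx => by
    have := abs_add_le (x - c) c
    rw [sub_add_cancel] at this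
    linarith [hr x hx]
  obtain ⟨z', hz'⟩ := hF.exists_graph_of_bounded hS hSb hzS
  -- Subtract the form bounds at `u + t z` and `u - t z`; the parallelogram law evaluates the right
  -- side.
  have pol : ∀ t : ℝ, 4 * t * ‖z‖ ^ 2 ≤ 2 * r * (‖u‖ ^ 2 + t ^ 2 * ‖z‖ ^ 2) := by
    intro t
    have ht : ((t : ℂ) • z, (t : ℂ) • z') ∈ A.graph := A.graph.smul_mem _ hz'
    have hp : (u + (t : ℂ) • z, v + (t : ℂ) • z') ∈ A.graph := A.graph.add_mem h ht
    have hm : (u - (t : ℂ) • z, v - (t : ℂ) • z') ∈ A.graph := A.graph.sub_mem h ht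
    have e1 := hF.abs_re_inner_sub_le hS hr hp (by rw [map_add, map_smul, hu, hzS])
    have e2 := hF.abs_re_inner_sub_le hS hr hm (by rw [map_sub, map_smul, hu, hzS])
    have e3 : inner ℂ (u + (t : ℂ) • z) (v + (t : ℂ) • z' - (c : ℂ) • (u + (t : ℂ) • z)) -
        inner ℂ (u - (t : ℂ) • z) (v - (t : ℂ) • z' - (c : ℂ) • (u - (t : ℂ) • z)) =
        2 * t * (inner ℂ z z + inner ℂ z z) := by
      have s1 : inner ℂ u z' = inner ℂ v z := (inner_graph_symm hA h hz').symm
      have s2 : inner ℂ z z = inner ℂ v z - c * inner ℂ u z := by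
        conv_lhs => rw [hz]
        rw [← hz, inner_sub_left, inner_smul_left, conj_ofReal]
      have s3 : inner ℂ z z = inner ℂ z v - c * inner ℂ z u := by
        conv_lhs => rw [hz]
        rw [← hz]
        nth_rewrite 2 [hz]
        rw [inner_sub_right, inner_smul_right]
      simp only [inner_add_left, inner_add_right, inner_sub_left, inner_sub_right,
        inner_smul_left, inner_smul_right, conj_ofReal, s1]
      linear_combination (-2 * (t : ℂ)) * s2 + (-2 * (t : ℂ)) * s3
    have e4 := congrArg Complex.re e3
    rw [inner_self_eq_norm_sq_to_K, sub_re] at e4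
    have e5 : (2 * (t : ℂ) * (((‖z‖ : ℝ) : ℂ) ^ 2 + ((‖z‖ : ℝ) : ℂ) ^ 2)).re = 4 * t * ‖z‖ ^ 2 := by
      norm_cast
      ring
    have e6 := parallelogram_law_with_norm ℂ u ((t : ℂ) • z)
    have e7 : ‖(t : ℂ) • z‖ ^ 2 = t ^ 2 * ‖z‖ ^ 2 := by
      rw [norm_smul, mul_pow, norm_real, Real.norm_eq_abs, sq_abs]
    have e8 := e4.trans e5
    have a1 := (abs_le.1 e1).2
    have a2 := (abs_le.1 e2).1
    have e9 : ‖u + (t : ℂ) • z‖ ^ 2 + ‖u - (t : ℂ) • z‖ ^ 2 = 2 * (‖u‖ ^ 2 + t ^ 2 * ‖z‖ ^ 2) := by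
      rw [← e7]; nlinarith
    calc 4 * t * ‖z‖ ^ 2 ≤ r * (‖u + (t : ℂ) • z‖ ^ 2 + ‖u - (t : ℂ) • z‖ ^ 2) := by linarith
      _ = _ := by rw [e9]; ring
  by_cases hu0 : u = 0
  · have : v = 0 := LinearPMap.graph_fst_eq_zero_snd A h hu0
    simp [hz, this, hu0]
  -- Only `0 ≤ r` is needed here. It is not assumed, but follows from the form bound because `u ≠
  -- 0`.
  by_cases hz0 : z = 0
  · have h1 := hF.abs_re_inner_sub_le hS hr h hu
    rw [hz0, norm_zero]
    have h2 : 0 ≤ r * ‖u‖ ^ 2 := (abs_nonneg _).trans h1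
    have h3 : 0 < ‖u‖ := norm_pos_iff.2 hu0
    by_contra hneg
    push Not at hneg
    nlinarith
  have hup : 0 < ‖u‖ := norm_pos_iff.2 hu0
  have hzp : 0 < ‖z‖ := norm_pos_iff.2 hz0
  -- This `t` balances the two terms on the right of `pol`.
  have h1 := pol (‖u‖ / ‖z‖)
  have h2 : 4 * (‖u‖ / ‖z‖) * ‖z‖ ^ 2 = 4 * ‖u‖ * ‖z‖ := by field_simp
  have h3 : (‖u‖ / ‖z‖) ^ 2 * ‖z‖ ^ 2 = ‖u‖ ^ 2 := by field_simp
  rw [h2, h3] at h1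
  have h4 : (4 * ‖u‖) * ‖z‖ ≤ (4 * ‖u‖) * (r * ‖u‖) := by nlinarith
  exact le_of_mul_le_mul_left h4 (by positivity)

/-- The scalar measure lives on `[b, ∞)`, so the form of `A - c` is at least `(b - c)‖u‖²`; conclude
by Cauchy–Schwarz. -/
theorem mul_norm_le_norm_sub_smul {b c : ℝ} {u v : K} (h : (u, v) ∈ A.graph)
    (hu : F.toFun (Ici b) u = u) : (b - c) * ‖u‖ ≤ ‖v - (c : ℂ) • u‖ := by
  have h1 : ∀ᵐ x ∂(F.scalar u), b - c ≤ x - c := by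
    rw [← hu, F.scalar_map u measurableSet_Ici, ae_restrict_iff' measurableSet_Ici]
    exact Eventually.of_forall fun x hx => sub_le_sub_right hx c
  have h2 := integral_mono_ae (integrable_const (b - c))
    ((hF.integrable_id h).sub (integrable_const c)) h1
  rw [integral_const, measureReal_def, F.scalar_univ, ENNReal.toReal_ofReal (by positivity)] at h2
  have h3 := hF.inner_sub_eq_integral h c
  have h4 := norm_inner_le_norm (𝕜 := ℂ) u (v - (c : ℂ) • u)
  rw [h3, norm_real] at h4
  have h5 : ‖u‖ * ((b - c) * ‖u‖) ≤ ‖u‖ * ‖v - (c : ℂ) • u‖ := by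
    calc ‖u‖ * ((b - c) * ‖u‖) = ‖u‖ ^ 2 • (b - c) := by simp; ring
      _ ≤ _ := h2
      _ ≤ _ := (le_abs_self _).trans h4
  by_cases hu0 : u = 0
  · simp [hu0]
  · exact le_of_mul_le_mul_left h5 (norm_pos_iff.2 hu0)

/-! ### Intertwining of spectral projections -/

variable {B : K →ₗ.[ℂ] K} {G : PVM K} (hG : IsSpectralMeasure B G)
include hG

/-- Let `Q` be the product. Around the midpoint `c` of `[a, b]`, `A - c` has norm at most `r` on the
range of `F(S)`, while `B - c` is bounded below by `E - c > r` on that of `G([E, ∞))`. As `(B - c)Q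
= Q(A - c)F(S)`, this gives `‖Q‖ ≤ (r / (E - c)) ‖Q‖`, hence `Q = 0`. -/
theorem map_Ici_mul_mul_map_eq_zero (hA : IsSelfAdjoint A) (hB : IsSelfAdjoint B) {J : K →L[ℂ] K}
    (hJ : ∀ u v, (u, v) ∈ A.graph → (J u, J v) ∈ B.graph) {E a b : ℝ} (hab : a ≤ b) (hbE : b < E)
    {S : Set ℝ} (hS : MeasurableSet S) (hSab : S ⊆ Icc a b) :
    G.toFun (Ici E) * J * F.toFun S = 0 := by
  set Q := G.toFun (Ici E) * J * F.toFun S with hQ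
  have hQx : ∀ x, Q x = G.toFun (Ici E) (J (F.toFun S x)) := fun x => rfl
  set c := (a + b) / 2
  set r := (b - a) / 2
  have hr0 : 0 ≤ r := by simp only [r]; linarith
  have hβ : r < E - c := by simp only [r, c]; linarith
  have hr : ∀ x ∈ S, |x - c| ≤ r := by
    intro x hx
    have := hSab hx
    rw [abs_le]
    simp only [r, c]
    exact ⟨by linarith [this.1], by linarith [this.2]⟩
  have hSb : ∀ x ∈ S, |x| ≤ r + |c| := fun x hx => by
    have := abs_add_le (x - c) c
    rw [sub_add_cancel] at this
    linarith [hr x hx]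
  have bound : ∀ x, ‖Q x‖ ≤ (r / (E - c) * ‖Q‖) * ‖x‖ := by
    intro x
    have hu := F.map_apply_map hS x
    obtain ⟨v, hv⟩ := hF.exists_graph_of_bounded hS hSb hu
    have hFv : F.toFun S v = v := by
      have h1 := hF.map_mem_graph hA hv hS
      rw [hu] at h1
      exact LinearPMap.mem_graph_snd_inj A h1 hv rfl
    have h1 := hG.map_mem_graph hB (hJ _ _ hv) (measurableSet_Ici (a := E))
    have h2 := hG.mul_norm_le_norm_sub_smul (c := c) h1 (G.map_apply_map measurableSet_Ici _)
    have h3 := hF.norm_sub_smul_le hA hS hr hv hu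
    have h4 : G.toFun (Ici E) (J v) - (c : ℂ) • G.toFun (Ici E) (J (F.toFun S x)) =
        Q (v - (c : ℂ) • F.toFun S x) := by
      rw [hQx, map_sub, map_smul, hFv, hu, map_sub, map_sub, map_smul, map_smul]
    rw [h4, ← hQx] at h2
    have h5 := Q.le_opNorm (v - (c : ℂ) • F.toFun S x)
    have h6 := F.norm_map_apply_le hS x
    have h7 : (E - c) * ‖Q x‖ ≤ r * ‖Q‖ * ‖x‖ := by
      calc (E - c) * ‖Q x‖ ≤ ‖Q‖ * ‖v - (c : ℂ) • F.toFun S x‖ := h2.trans h5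
        _ ≤ ‖Q‖ * (r * ‖x‖) := by gcongr; exact h3.trans (by gcongr)
        _ = _ := by ring
    have hpos : 0 < E - c := hr0.trans_lt hβ
    rw [div_mul_eq_mul_div, div_mul_eq_mul_div, le_div_iff₀ hpos]
    linarith
  have hpos : 0 < E - c := hr0.trans_lt hβ
  have h8 := Q.opNorm_le_bound (by positivity) bound
  rw [div_mul_eq_mul_div, le_div_iff₀ hpos] at h8
  have h9 : ‖Q‖ = 0 := by nlinarith [norm_nonneg Q]
  exact norm_eq_zero.1 h9

theorem map_Ici_mul_mul_map_Iio_eq_zero (hA : IsSelfAdjoint A) (hB : IsSelfAdjoint B)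
    {J : K →L[ℂ] K} (hJ : ∀ u v, (u, v) ∈ A.graph → (J u, J v) ∈ B.graph) (E : ℝ) :
    G.toFun (Ici E) * J * F.toFun (Iio E) = 0 := by
  -- Bounded intervals at positive distance from `E` exhaust `(-∞, E)`; they are made disjoint so
  -- that countable additivity applies.
  let g : ℕ → Set ℝ := fun n => Icc (E - n - 1) (E - 1 / (n + 1))
  have hg : ∀ n, MeasurableSet (g n) := fun n => measurableSet_Icc
  have hU : (⋃ n, disjointed g n) = Iio E := by
    rw [iUnion_disjointed]
    ext x
    simp only [g, mem_iUnion, mem_Icc, mem_Iio]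
    constructor
    · rintro ⟨n, -, h⟩
      have : (0 : ℝ) < 1 / (n + 1) := by positivity
      linarith
    · intro hx
      obtain ⟨n, hn⟩ := exists_nat_one_div_lt (sub_pos.2 hx)
      obtain ⟨m, hm⟩ := exists_nat_ge (E - x)
      refine ⟨max n m, ?_, ?_⟩
      · have : (m : ℝ) ≤ (max n m : ℕ) := by exact_mod_cast le_max_right n m
        linarith
      · have h1 : (1 : ℝ) / ((max n m : ℕ) + 1) ≤ 1 / (n + 1) := by
          apply one_div_le_one_div_of_le (by positivity)
          have : (n : ℝ) ≤ (max n m : ℕ) := by exact_mod_cast le_max_left n m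
          linarith
        linarith
  ext x
  have h1 := F.hasSum_iUnion (disjointed g) (fun n => MeasurableSet.disjointed hg n)
    (disjoint_disjointed g) x
  rw [hU] at h1
  have h2 := h1.mapL (G.toFun (Ici E) * J)
  have h3 : ∀ n, (G.toFun (Ici E) * J) (F.toFun (disjointed g n) x) = 0 := by
    intro n
    have hn : (1 : ℝ) / (n + 1) ≤ 1 := by
      rw [div_le_one (by positivity)]
      linarith [n.cast_nonneg (α := ℝ)]
    have hn' : (0 : ℝ) < 1 / (n + 1) := by positivity
    have := map_Ici_mul_mul_map_eq_zero hF hG hA hB hJ (E := E) (a := E - n - 1)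
      (b := E - 1 / (n + 1)) (by linarith [n.cast_nonneg (α := ℝ)]) (by linarith)
      (MeasurableSet.disjointed hg n) (disjointed_subset g n)
    exact congrArg (fun T : K →L[ℂ] K => T x) this
  simp only [h3] at h2
  exact h2.unique hasSum_zero

/-- A self-adjoint bounded operator that intertwines two self-adjoint operators (in both
directions) intertwines their spectral projections. -/
theorem mul_map_Iio_eq (hA : IsSelfAdjoint A) (hB : IsSelfAdjoint B)
    {J : K →L[ℂ] K} (hJs : IsSelfAdjoint J) (hJ : ∀ u v, (u, v) ∈ A.graph → (J u, J v) ∈ B.graph)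
    (hJ' : ∀ u v, (u, v) ∈ B.graph → (J u, J v) ∈ A.graph) (E : ℝ) :
    J * F.toFun (Iio E) = G.toFun (Iio E) * J := by
  have h1 := map_Ici_mul_mul_map_Iio_eq_zero hF hG hA hB hJ E
  have h2 := map_Ici_mul_mul_map_Iio_eq_zero hG hF hB hA hJ' E
  have cF : F.toFun (Ici E) = 1 - F.toFun (Iio E) := by
    ext x; rw [← compl_Iio, F.map_compl_apply measurableSet_Iio]; rfl
  have cG : G.toFun (Ici E) = 1 - G.toFun (Iio E) := by
    ext x; rw [← compl_Iio, G.map_compl_apply measurableSet_Iio]; rfl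
  -- The adjoint of the second relation supplies the opposite off-diagonal block `G(Iio E) J F(Ici
  -- E) = 0`.
  have h3 := congrArg star h2
  rw [star_mul, star_mul, (F.isStarProjection _ measurableSet_Ici).isSelfAdjoint.star_eq,
    (G.isStarProjection _ measurableSet_Iio).isSelfAdjoint.star_eq, hJs.star_eq, star_zero, cF,
    mul_sub, mul_sub, mul_one, sub_eq_zero] at h3
  rw [cG, sub_mul, sub_mul, one_mul, sub_eq_zero] at h1
  rw [h1, mul_assoc, ← h3]

end IsSpectralMeasure

/-! ### Eigenprojections, traces -/

theorem isStarProjection_eq_of_forall {P Q : K →L[ℂ] K} (hP : IsStarProjection P)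
    (hQ : IsStarProjection Q) (h : ∀ u, P u = u ↔ Q u = u) : P = Q := by
  have h1 : P * Q = Q := by
    ext u
    refine (h (Q u)).2 ?_
    exact congrArg (fun T : K →L[ℂ] K => T u) hQ.isIdempotentElem.eq
  have h2 : Q * P = P := by
    ext u
    refine (h (P u)).1 ?_
    exact congrArg (fun T : K →L[ℂ] K => T u) hP.isIdempotentElem.eq
  have h3 := congrArg star h1
  rw [star_mul, hP.isSelfAdjoint.star_eq, hQ.isSelfAdjoint.star_eq] at h3
  rw [← h2, h3]

theorem conj_conj_of_mul_self {R : Type*} [Ring R] {U : R} (hU : U * U = 1) (A : R) :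
    U * (U * A * U) * U = A := by
  calc U * (U * A * U) * U = (U * U) * A * (U * U) := by simp only [mul_assoc]
    _ = A := by rw [hU, one_mul, mul_one]

theorem conj_mul_conj_of_mul_self {R : Type*} [Ring R] {U : R} (hU : U * U = 1) (A B : R) :
    (U * A * U) * (U * B * U) = U * (A * B) * U := by
  calc (U * A * U) * (U * B * U) = U * A * (U * U) * B * U := by simp only [mul_assoc]
    _ = U * (A * B) * U := by rw [hU, mul_one]; simp only [mul_assoc]

theorem isStarProjection_conj {P U : K →L[ℂ] K} (hP : IsStarProjection P) (hU : IsSelfAdjoint U)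
    (hUU : U * U = 1) : IsStarProjection (U * P * U) := by
  refine ⟨?_, ?_⟩
  · rw [IsIdempotentElem, conj_mul_conj_of_mul_self hUU, hP.isIdempotentElem.eq]
  · rw [IsSelfAdjoint, star_mul, star_mul, hU.star_eq, hP.isSelfAdjoint.star_eq, mul_assoc]

omit [CompleteSpace K] in
theorem mem_opSpectrum_of_eigenvector {A : K →ₗ.[ℂ] K} {z : ℂ} {u : K} (hu : u ≠ 0)
    (h : (u, z • u) ∈ A.graph) : z ∈ opSpectrum A := by
  rintro ⟨R, -, hR⟩
  have := hR _ _ h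
  rw [sub_self, map_zero] at this
  exact hu this.symm

omit [CompleteSpace K] in
theorem HasTrace.neg {A : K →L[ℂ] K} {τ : ℂ} (h : HasTrace A τ) : HasTrace (-A) (-τ) := by
  intro ι b
  simpa using (h ι b).neg

theorem HasTrace.unique {A : K →L[ℂ] K} {τ τ' : ℂ} (h : HasTrace A τ) (h' : HasTrace A τ') :
    τ = τ' := by
  obtain ⟨w, b, -⟩ := exists_hilbertBasis ℂ K
  exact (h w b).unique (h' w b)

theorem HasTrace.trace_eq {A : K →L[ℂ] K} {τ : ℂ} (h : HasTrace A τ) : trace A = τ := by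
  have hex : ∃ τ, HasTrace A τ := ⟨τ, h⟩
  rw [trace, dif_pos hex]
  exact hex.choose_spec.unique h

theorem trace_neg (A : K →L[ℂ] K) : trace (-A) = -trace A := by
  by_cases h : ∃ τ, HasTrace A τ
  · obtain ⟨τ, h⟩ := h
    rw [h.trace_eq, h.neg.trace_eq]
  -- `A` and `-A` have a trace together, so otherwise both sides take the default value `0`.
  · have h' : ¬ ∃ τ, HasTrace (-A) τ := fun ⟨τ, hτ⟩ => h ⟨-τ, by simpa using hτ.neg⟩
    rw [trace, trace, dif_neg h, dif_neg h', neg_zero]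

/-- `U` is unitary and maps Hilbert bases to Hilbert bases, and `HasTrace` covers every basis. -/
theorem HasTrace.conj {U A : K →L[ℂ] K} (hU : IsSelfAdjoint U) (hUU : U * U = 1) {τ : ℂ}
    (h : HasTrace A τ) : HasTrace (U * A * U) τ := by
  intro ι b
  have hUU' : ∀ x, U (U x) = x := fun x => congrArg (fun T : K →L[ℂ] K => T x) hUU
  have hadj : ∀ x y, inner ℂ (U x) y = inner ℂ x (U y) := fun x y => by
    conv_lhs => rw [← (show ContinuousLinearMap.adjoint U = U from hU)]
    exact ContinuousLinearMap.adjoint_inner_left _ _ _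
  let V : K ≃ₗᵢ[ℂ] K :=
    { toLinearEquiv := LinearEquiv.ofInvolutive (U : K →ₗ[ℂ] K) hUU'
      norm_map' := fun x => by
        change ‖U x‖ = ‖x‖
        rw [@norm_eq_sqrt_re_inner ℂ, @norm_eq_sqrt_re_inner ℂ _ _ _ _ x, hadj, hUU'] }
  let b' : HilbertBasis ι ℂ K := HilbertBasis.ofRepr (V.trans b.repr)
  have hb' : ∀ i, b' i = U (b i) := by
    intro i
    classical
    rw [← HilbertBasis.repr_symm_single, ← HilbertBasis.repr_symm_single]
    rfl
  have h1 := h ι b'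
  simp only [hb', hadj] at h1
  exact h1

theorem trace_conj {U : K →L[ℂ] K} (hU : IsSelfAdjoint U) (hUU : U * U = 1) (A : K →L[ℂ] K) :
    trace (U * A * U) = trace A := by
  by_cases h : ∃ τ, HasTrace A τ
  · obtain ⟨τ, h⟩ := h
    rw [h.trace_eq, (h.conj hU hUU).trace_eq]
  · have h' : ¬ ∃ τ, HasTrace (U * A * U) τ := fun ⟨τ, hτ⟩ => h ⟨τ, by
      have := hτ.conj hU hUU
      rwa [conj_conj_of_mul_self hUU] at this⟩
    rw [trace, trace, dif_neg h, dif_neg h']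

/-- The minus sign on the conjugate of `C` anticipates the momentum derivative, which changes sign
under `k ↦ -k`. -/
theorem trace_commutator_conj {U : K →L[ℂ] K} (hU : IsSelfAdjoint U) (hUU : U * U = 1)
    (A B C : K →L[ℂ] K) :
    trace ((U * A * U) * ((U * B * U) * -(U * C * U) - -(U * C * U) * (U * B * U))) =
      -trace (A * (B * C - C * B)) := by
  have h : (U * A * U) * ((U * B * U) * -(U * C * U) - -(U * C * U) * (U * B * U)) =
      -(U * (A * (B * C - C * B)) * U) := by
    rw [mul_neg, neg_mul, conj_mul_conj_of_mul_self hUU, conj_mul_conj_of_mul_self hUU,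
      ← conj_mul_conj_of_mul_self hUU A, mul_sub U, sub_mul, ← mul_neg (U * A * U)]
    congr 1
    abel
  rw [h, trace_neg, trace_conj hU hUU]

end Operators

variable {d : ℕ}

/-! ### Geometry of the centered fundamental domain -/

theorem latticePoint_neg (v : Fin d → Space d) (n : Fin d → ℤ) :
    latticePoint v (-n) = -latticePoint v n := by
  simp [latticePoint]

theorem latticePoint_zero (v : Fin d → Space d) : latticePoint v 0 = 0 := by
  simp [latticePoint]

theorem latticePoint_sub (v : Fin d → Space d) (m n : Fin d → ℤ) :
    latticePoint v (m - n) = latticePoint v m - latticePoint v n := by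
  simp [latticePoint, sub_smul]

theorem repr_latticePoint (b : Module.Basis (Fin d) ℝ (Space d)) (n : Fin d → ℤ) (l : Fin d) :
    b.repr (latticePoint b n) l = n l := by
  have := congrFun (b.equivFun.apply_symm_apply (fun l => (n l : ℝ))) l
  rwa [b.equivFun_symm_apply] at this

theorem mem_cell_iff (b : Module.Basis (Fin d) ℝ (Space d)) (x : Space d) :
    x ∈ cell b ↔ ∀ l, b.repr x l ∈ Icc (-(1 / 2) : ℝ) (1 / 2) := by
  constructor
  · rintro ⟨ζ, hζ, rfl⟩ l
    have := congrFun (b.equivFun.apply_symm_apply ζ) l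
    rw [b.equivFun_symm_apply, b.equivFun_apply] at this
    rw [this]
    exact hζ l
  · intro h
    exact ⟨fun l => b.repr x l, h, (b.sum_repr x).symm⟩

theorem isCompact_cell (v : Fin d → Space d) : IsCompact (cell v) := by
  have h : cell v = (fun ζ : Fin d → ℝ => ∑ l, ζ l • v l) ''
      (univ.pi fun _ => Icc (-(1 / 2) : ℝ) (1 / 2)) := by
    ext x
    simp only [cell, mem_ofPred_eq, mem_image, mem_univ_pi]
    exact exists_congr fun ζ => and_congr_right fun _ => eq_comm
  rw [h]
  exact (isCompact_univ_pi fun _ => isCompact_Icc).image (by fun_prop)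

theorem measurableSet_cell (v : Fin d → Space d) : MeasurableSet (cell v) :=
  (isCompact_cell v).isClosed.measurableSet

theorem continuous_repr (b : Module.Basis (Fin d) ℝ (Space d)) (l : Fin d) :
    Continuous fun x => b.repr x l :=
  LinearMap.continuous_of_finiteDimensional (b.coord l)

/-- A convex set with nonempty interior lies in the closure of its interior. This allows
almost-everywhere identities of continuous functions to hold on the boundary of the cell too. -/
theorem cell_subset_closure_interior (b : Module.Basis (Fin d) ℝ (Space d)) :
    cell b ⊆ closure (interior (cell b)) := by
  have hc : cell b = ⋂ l, (b.coord l) ⁻¹' Icc (-(1 / 2) : ℝ) (1 / 2) := by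
    ext x; simp [mem_cell_iff]
  have hconv : Convex ℝ (cell b) := by
    rw [hc]
    exact convex_iInter fun l => (convex_Icc _ _).linear_preimage (b.coord l)
  have h0 : (interior (cell b)).Nonempty := by
    refine ⟨0, mem_interior_iff_mem_nhds.2 ?_⟩
    rw [hc]
    refine iInter_mem.2 fun l => ?_
    refine (continuous_repr b l).continuousAt.preimage_mem_nhds ?_
    simp
  rw [hconv.closure_interior_eq_closure_of_nonempty_interior h0]
  exact subset_closure

theorem exists_sub_latticePoint_mem_cell (b : Module.Basis (Fin d) ℝ (Space d)) (x : Space d) :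
    ∃ n, x - latticePoint b n ∈ cell b := by
  refine ⟨fun l => round (b.repr x l), (mem_cell_iff b _).2 fun l => ?_⟩
  rw [map_sub, Finsupp.sub_apply, repr_latticePoint, mem_Icc, ← abs_le]
  exact abs_sub_round _

theorem volume_repr_eq (b : Module.Basis (Fin d) ℝ (Space d)) (l : Fin d) (c : ℝ) :
    volume {x : Space d | b.repr x l = c} = 0 := by
  let e := b.equivFunL
  have h1 : (volume.map e).IsAddHaarMeasure := inferInstance
  obtain ⟨r, hr⟩ : ∃ r : NNReal, volume.map e = r • (volume : Measure (Fin d → ℝ)) :=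
    ⟨_, Measure.isAddLeftInvariant_eq_smul (volume.map e) volume⟩
  have h2 : volume {ζ : Fin d → ℝ | ζ l = c} = 0 := by
    rw [volume_pi]; exact Measure.pi_hyperplane (α := fun _ => ℝ) (fun _ => volume) l c
  have h3 : (volume.map e) {ζ : Fin d → ℝ | ζ l = c} = 0 := by
    rw [hr]; simp [h2]
  rwa [Measure.map_apply e.continuous.measurable
    (measurableSet_eq_fun (measurable_pi_apply l) measurable_const)] at h3

/-- Distinct lattice translates of the fundamental domain overlap only in a null set. -/
theorem volume_cell_inter_translate (b : Module.Basis (Fin d) ℝ (Space d)) {n : Fin d → ℤ}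
    (hn : n ≠ 0) : volume {x | x ∈ cell b ∧ x + latticePoint b n ∈ cell b} = 0 := by
  obtain ⟨l, hl⟩ := Function.ne_iff.1 hn
  -- If `n l ≠ 0`, having both `x_l` and `x_l + n l` in `[-1/2, 1/2]` forces `x_l = ±1/2`.
  refine measure_mono_null (t := {x | b.repr x l = 1 / 2} ∪ {x | b.repr x l = -(1 / 2)}) ?_
    (measure_union_null (volume_repr_eq b l _) (volume_repr_eq b l _))
  rintro x ⟨h1, h2⟩
  have h1 := (mem_cell_iff b _).1 h1 l
  have h2 := (mem_cell_iff b _).1 h2 l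
  rw [map_add, Finsupp.add_apply, repr_latticePoint] at h2
  rcases lt_or_gt_of_ne hl with h | h
  · left
    have h3 : (n l : ℝ) ≤ -1 := by exact_mod_cast Int.le_sub_one_of_lt h
    exact le_antisymm h1.2 (by linarith [h2.1])
  · right
    have h3 : (1 : ℝ) ≤ n l := by exact_mod_cast h
    exact le_antisymm (by linarith [h2.2]) h1.1

theorem linearIndependent_dualGen (γ : Module.Basis (Fin d) ℝ (Space d)) :
    LinearIndependent ℝ (dualGen γ) := by
  rw [Fintype.linearIndependent_iff]
  intro c hc l
  have h := congrArg (fun x => inner ℝ x (γ l)) hc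
  simp only [sum_inner, inner_smul_left, inner_dualGen, inner_zero_left] at h
  simpa [Real.pi_ne_zero] using h

/-- The basis of the dual lattice. -/
def dualBasis (γ : Module.Basis (Fin d) ℝ (Space d)) : Module.Basis (Fin d) ℝ (Space d) :=
  Module.Basis.mk (linearIndependent_dualGen γ)
    ((linearIndependent_dualGen γ).span_eq_top_of_card_eq_finrank' (by simp)).ge

theorem coe_dualBasis (γ : Module.Basis (Fin d) ℝ (Space d)) : ⇑(dualBasis γ) = dualGen γ :=
  Module.Basis.coe_mk _ _

theorem brillouin_eq (γ : Module.Basis (Fin d) ℝ (Space d)) :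
    brillouin γ = cell (dualBasis γ) := by
  rw [coe_dualBasis, brillouin]

instance isFiniteMeasure_restrict_brillouin (γ : Module.Basis (Fin d) ℝ (Space d)) :
    IsFiniteMeasure (volume.restrict (brillouin γ)) :=
  ⟨by rw [Measure.restrict_apply_univ]; exact (isCompact_cell _).measure_lt_top⟩

theorem integral_exp_two_pi_int {m : ℤ} (hm : m ≠ 0) :
    ∫ x in Icc (-(1 / 2) : ℝ) (1 / 2), cexp (2 * Real.pi * m * I * x) = 0 := by
  have hc : (2 * Real.pi * m * I : ℂ) ≠ 0 := by
    simp [Real.pi_ne_zero, hm]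
  rw [integral_Icc_eq_integral_Ioc, ← intervalIntegral.integral_of_le (by norm_num),
    integral_exp_mul_complex hc, div_eq_zero_iff]
  left
  -- The endpoints differ by `m` full periods.
  have h : (2 * Real.pi * m * I * ((1 / 2 : ℝ) : ℂ)) =
      2 * Real.pi * m * I * ((-(1 / 2) : ℝ) : ℂ) + m * (2 * Real.pi * I) := by
    push_cast; ring
  rw [h, Complex.exp_add, exp_int_mul_two_pi_mul_I, mul_one, sub_self]

/-- Orthogonality of the characters of the dual torus. -/
theorem integral_brillouin_exp (γ : Module.Basis (Fin d) ℝ (Space d)) {n : Fin d → ℤ}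
    (hn : n ≠ 0) :
    ∫ k in brillouin γ, cexp (I * (inner ℝ (latticePoint γ n) k : ℝ)) = 0 := by
  obtain ⟨l, hl⟩ := Function.ne_iff.1 hn
  -- In dual coordinates the zone is a cube, volume is a multiple of Lebesgue measure, and the
  -- character factorizes; the factor at `l` integrates to zero.
  let e := (dualBasis γ).equivFunL
  have h1 : (volume.map e).IsAddHaarMeasure := inferInstance
  obtain ⟨r, hr⟩ : ∃ r : NNReal, volume.map e = r • (volume : Measure (Fin d → ℝ)) :=
    ⟨_, Measure.isAddLeftInvariant_eq_smul (volume.map e) volume⟩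
  have hpre : brillouin γ = e ⁻¹' (univ.pi fun _ => Icc (-(1 / 2) : ℝ) (1 / 2)) := by
    ext x
    rw [brillouin_eq, mem_cell_iff, mem_preimage, mem_univ_pi]
    rfl
  have hf : ∀ k, cexp (I * (inner ℝ (latticePoint γ n) k : ℝ)) =
      ∏ j, cexp (2 * Real.pi * n j * I * (e k j : ℝ)) := by
    intro k
    rw [← Complex.exp_sum]
    congr 1
    have h2 : inner ℝ (latticePoint γ n) k = ∑ j, 2 * Real.pi * n j * e k j := by
      conv_lhs => rw [← (dualBasis γ).sum_repr k]
      simp only [latticePoint, inner_sum, sum_inner, inner_smul_left, inner_smul_right,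
        coe_dualBasis]
      refine Finset.sum_congr rfl fun j _ => ?_
      have h3 : ∀ i, inner ℝ (γ i) (dualGen γ j) = if j = i then 2 * Real.pi else 0 := fun i => by
        rw [real_inner_comm, inner_dualGen]
      simp only [h3, mul_ite, mul_zero, Finset.sum_ite_eq, Finset.mem_univ, if_true]
      simp [e]
      ring
    rw [h2]
    push_cast
    rw [Finset.mul_sum]
    exact Finset.sum_congr rfl fun j _ => by ring
  simp only [hf]
  have hmp : MeasurePreserving e volume (volume.map e) :=
    ⟨e.continuous.measurable, rfl⟩
  rw [hpre, hmp.setIntegral_preimage_emb e.toHomeomorph.measurableEmbedding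
    (fun ζ : Fin d → ℝ => ∏ j, cexp (2 * Real.pi * n j * I * (ζ j : ℝ))), hr,
    Measure.restrict_smul, integral_smul_nnreal_measure, volume_pi, Measure.restrict_pi_pi,
    integral_fintype_prod_eq_prod (f := fun j (x : ℝ) => cexp (2 * Real.pi * n j * I * (x : ℝ))),
    Finset.prod_eq_zero (Finset.mem_univ l) (integral_exp_two_pi_int hl), smul_zero]

/-! ### Phases and translations in the fibre space -/

variable (γ : Module.Basis (Fin d) ℝ (Space d))

/-- Multiplication by `y ↦ exp (-i (y + a)·k)` in the fibre space. -/
def shiftPhase (a k : Space d) (u : Fiber γ) : Fiber γ := (memLp_phase (Lp.memLp u) a k).toLp _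

theorem coeFn_shiftPhase (a k : Space d) (u : Fiber γ) :
    shiftPhase γ a k u =ᵐ[volume.restrict (cell γ)]
      fun y => cexp (-(I * (inner ℝ (y + a) k : ℝ))) * u y :=
  MemLp.coeFn_toLp _

theorem coeFn_phase (κ : Space d) (u : Fiber γ) :
    phase γ κ u =ᵐ[volume.restrict (cell γ)] fun y => cexp (-(I * (inner ℝ y κ : ℝ))) * u y := by
  have := coeFn_shiftPhase γ 0 κ u
  simp only [add_zero] at this
  exact this

/-- The restriction to the fundamental domain of the translate of `ψ` by `a`. -/
def translateFiber (ψ : L2Space d) (a : Space d) : Fiber γ := (memLp_translate γ ψ a).toLp _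

theorem coeFn_translateFiber (ψ : L2Space d) (a : Space d) :
    translateFiber γ ψ a =ᵐ[volume.restrict (cell γ)] fun y => ψ (y + a) :=
  MemLp.coeFn_toLp _

theorem coeFn_zakTerm (ψ : L2Space d) (n : Fin d → ℤ) (k : Space d) :
    zakTerm γ ψ n k =ᵐ[volume.restrict (cell γ)] fun y =>
      cexp (-(I * (inner ℝ (y + latticePoint γ n) k : ℝ))) * ψ (y + latticePoint γ n) :=
  MemLp.coeFn_toLp _

theorem zakTerm_eq (ψ : L2Space d) (n : Fin d → ℤ) (k : Space d) :
    zakTerm γ ψ n k = shiftPhase γ (latticePoint γ n) k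
      (translateFiber γ ψ (latticePoint γ n)) := by
  refine Lp.ext ?_
  filter_upwards [coeFn_zakTerm γ ψ n k, coeFn_translateFiber γ ψ (latticePoint γ n),
    coeFn_shiftPhase γ (latticePoint γ n) k (translateFiber γ ψ (latticePoint γ n))]
    with y h1 h2 h3
  rw [h1, h3, h2]

theorem inner_shiftPhase (a b k : Space d) (u v : Fiber γ) :
    inner ℂ (shiftPhase γ a k u) (shiftPhase γ b k v) =
      cexp (I * (inner ℝ (a - b) k : ℝ)) * inner ℂ u v := by
  rw [L2.inner_def, L2.inner_def, ← integral_const_mul]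
  refine integral_congr_ae ?_
  filter_upwards [coeFn_shiftPhase γ a k u, coeFn_shiftPhase γ b k v] with y h1 h2
  rw [h1, h2]
  simp only [RCLike.inner_apply, map_mul, ← exp_conj, map_neg, conj_I, conj_ofReal]
  have : cexp (I * (inner ℝ (a - b) k : ℝ)) =
      cexp (-(I * (inner ℝ (y + b) k : ℝ))) * cexp (-(-I * (inner ℝ (y + a) k : ℝ))) := by
    rw [← Complex.exp_add]
    congr 1
    rw [inner_sub_left, inner_add_left, inner_add_left]
    push_cast
    ring
  rw [this]
  ring

theorem norm_shiftPhase (a k : Space d) (u : Fiber γ) : ‖shiftPhase γ a k u‖ = ‖u‖ := by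
  have h := inner_shiftPhase γ a a k u u
  rw [sub_self, inner_zero_left, ofReal_zero, mul_zero, Complex.exp_zero, one_mul] at h
  rw [@norm_eq_sqrt_re_inner ℂ, @norm_eq_sqrt_re_inner ℂ _ _ _ _ u, h]

theorem norm_exp_sub_exp_le (x y : ℝ) : ‖cexp (-(I * x)) - cexp (-(I * y))‖ ≤ |x - y| := by
  have h : cexp (-(I * x)) - cexp (-(I * y)) =
      cexp (I * ((-y : ℝ) : ℂ)) * (cexp (I * ((y - x : ℝ) : ℂ)) - 1) := by
    rw [mul_sub, ← Complex.exp_add, mul_one]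
    congr 2 <;> push_cast <;> ring
  rw [h, norm_mul, norm_exp_I_mul_ofReal, one_mul, abs_sub_comm]
  exact Real.norm_exp_I_mul_ofReal_sub_one_le

/-- `y + a` is bounded on the cell, so the phase is Lipschitz in `k` uniformly in `y`. -/
theorem continuous_shiftPhase (a : Space d) (u : Fiber γ) :
    Continuous fun k => shiftPhase γ a k u := by
  obtain ⟨C, hC⟩ := (isCompact_cell (γ : Fin d → Space d)).isBounded.exists_norm_le
  have hC' : ∀ y ∈ cell γ, ‖y + a‖ ≤ |C| + ‖a‖ := fun y hy =>
    (norm_add_le _ _).trans (by linarith [hC y hy, le_abs_self C])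
  refine LipschitzWith.continuous (K := Real.toNNReal ((|C| + ‖a‖) * ‖u‖)) ?_
  refine LipschitzWith.of_dist_le_mul fun k k' => ?_
  rw [dist_eq_norm, dist_eq_norm, Real.coe_toNNReal _ (by positivity)]
  have : ‖shiftPhase γ a k u - shiftPhase γ a k' u‖ ≤ ((|C| + ‖a‖) * ‖k - k'‖) * ‖u‖ := by
    refine Lp.norm_le_mul_norm_of_ae_le_mul ?_
    filter_upwards [coeFn_shiftPhase γ a k u, coeFn_shiftPhase γ a k' u,
      Lp.coeFn_sub (shiftPhase γ a k u) (shiftPhase γ a k' u),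
      ae_restrict_mem (measurableSet_cell (γ : Fin d → Space d))] with y h1 h2 h3 h4
    rw [h3, Pi.sub_apply, h1, h2, ← sub_mul, norm_mul]
    gcongr
    refine (norm_exp_sub_exp_le _ _).trans ?_
    rw [← inner_sub_right]
    exact (abs_real_inner_le_norm _ _).trans (by gcongr; exact hC' y h4)
  linarith

theorem phase_phase_neg (κ : Space d) (u : Fiber γ) : phase γ κ (phase γ (-κ) u) = u := by
  refine Lp.ext ?_
  filter_upwards [coeFn_phase γ κ (phase γ (-κ) u), coeFn_phase γ (-κ) u] with y h1 h2
  rw [h1, h2, ← mul_assoc, ← Complex.exp_add, inner_neg_right]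
  simp

theorem phase_neg_phase (κ : Space d) (u : Fiber γ) : phase γ (-κ) (phase γ κ u) = u := by
  have := phase_phase_neg γ (-κ) u
  rwa [neg_neg] at this

/-! ### Space reflection -/

theorem coeFn_fiberReflection (u : Fiber γ) :
    fiberReflection γ u =ᵐ[volume.restrict (cell γ)] fun y => u (-y) :=
  Lp.coeFn_compMeasurePreserving u (measurePreserving_neg_cell γ)

theorem coeFn_reflection (ψ : L2Space d) : reflection d ψ =ᵐ[volume] fun y => ψ (-y) :=
  Lp.coeFn_compMeasurePreserving ψ (Measure.measurePreserving_neg volume)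

theorem norm_fiberReflection (u : Fiber γ) : ‖fiberReflection γ u‖ = ‖u‖ :=
  Lp.norm_compMeasurePreserving u (measurePreserving_neg_cell γ)

theorem ae_neg_cell {p : Space d → Prop} (h : ∀ᵐ y ∂(volume.restrict (cell γ)), p y) :
    ∀ᵐ y ∂(volume.restrict (cell γ)), p (-y) :=
  (measurePreserving_neg_cell γ).quasiMeasurePreserving.ae h

theorem fiberReflection_fiberReflection (u : Fiber γ) :
    fiberReflection γ (fiberReflection γ u) = u := by
  refine Lp.ext ?_
  filter_upwards [coeFn_fiberReflection γ (fiberReflection γ u),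
    ae_neg_cell γ (coeFn_fiberReflection γ u)] with y h1 h2
  rw [h1, h2, neg_neg]

theorem fiberReflection_mul_self : fiberReflection γ * fiberReflection γ = 1 := by
  ext1 u
  exact fiberReflection_fiberReflection γ u

theorem isSelfAdjoint_fiberReflection : IsSelfAdjoint (fiberReflection γ) := by
  rw [ContinuousLinearMap.isSelfAdjoint_iff_isSymmetric]
  intro u v
  have h := (Lp.compMeasurePreservingₗᵢ ℂ (fun x : Space d => -x)
    (measurePreserving_neg_cell γ) : Fiber γ →ₗᵢ[ℂ] Fiber γ).inner_map_map u (fiberReflection γ v)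
  have h' : inner ℂ (fiberReflection γ u) (fiberReflection γ (fiberReflection γ v)) =
    inner ℂ u (fiberReflection γ v) := h
  rwa [fiberReflection_fiberReflection] at h'

theorem fiberReflection_phase (κ : Space d) (u : Fiber γ) :
    fiberReflection γ (phase γ κ u) = phase γ (-κ) (fiberReflection γ u) := by
  refine Lp.ext ?_
  filter_upwards [coeFn_fiberReflection γ (phase γ κ u), ae_neg_cell γ (coeFn_phase γ κ u),
    coeFn_phase γ (-κ) (fiberReflection γ u), coeFn_fiberReflection γ u] with y h1 h2 h3 h4
  rw [h1, h2, h3, h4, inner_neg_left, inner_neg_right]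

/-- The phase `(y + a)·k` is unchanged when `y`, `a` and `k` all change sign. -/
theorem zakTerm_reflection (ψ : L2Space d) (n : Fin d → ℤ) (k : Space d) :
    zakTerm γ (reflection d ψ) n k = fiberReflection γ (zakTerm γ ψ (-n) (-k)) := by
  have h0 : ∀ᵐ y ∂(volume.restrict (cell γ)),
      reflection d ψ (y + latticePoint γ n) = ψ (-(y + latticePoint γ n)) :=
    ae_restrict_of_ae ((measurePreserving_add_right volume
      (latticePoint γ n)).quasiMeasurePreserving.ae (coeFn_reflection ψ))
  refine Lp.ext ?_
  filter_upwards [coeFn_zakTerm γ (reflection d ψ) n k, h0,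
    coeFn_fiberReflection γ (zakTerm γ ψ (-n) (-k)),
    ae_neg_cell γ (coeFn_zakTerm γ ψ (-n) (-k))] with y h1 h2 h3 h4
  rw [h1, h2, h3, h4, latticePoint_neg, ← neg_add, inner_neg_neg]

/-! ### Existence of the Bloch-Floquet-Zak transform -/

theorem continuous_zakTerm (ψ : L2Space d) (n : Fin d → ℤ) : Continuous (zakTerm γ ψ n) := by
  have : zakTerm γ ψ n = fun k => shiftPhase γ (latticePoint γ n) k
      (translateFiber γ ψ (latticePoint γ n)) := funext fun k => zakTerm_eq γ ψ n k
  rw [this]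
  exact continuous_shiftPhase γ _ _

theorem memLp_zakTerm (ψ : L2Space d) (n : Fin d → ℤ) :
    MemLp (zakTerm γ ψ n) 2 (volume.restrict (brillouin γ)) := by
  refine MemLp.of_bound (continuous_zakTerm γ ψ n).aestronglyMeasurable
    ‖translateFiber γ ψ (latticePoint γ n)‖ (Eventually.of_forall fun k => ?_)
  rw [zakTerm_eq, norm_shiftPhase]

/-- The summands of the Bloch-Floquet-Zak transform as elements of `L²(Y*; L²(Y))`. -/
def zakLp (ψ : L2Space d) (n : Fin d → ℤ) : Lp (Fiber γ) 2 (volume.restrict (brillouin γ)) :=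
  (memLp_zakTerm γ ψ n).toLp _

theorem coeFn_zakLp (ψ : L2Space d) (n : Fin d → ℤ) :
    zakLp γ ψ n =ᵐ[volume.restrict (brillouin γ)] zakTerm γ ψ n :=
  MemLp.coeFn_toLp _

/-- The `y`-dependent phases cancel, leaving a character of `k`; distinct terms are therefore
orthogonal. -/
theorem inner_zakLp (ψ : L2Space d) (m n : Fin d → ℤ) :
    inner ℂ (zakLp γ ψ m) (zakLp γ ψ n) =
      (∫ k in brillouin γ, cexp (I * (inner ℝ (latticePoint γ (m - n)) k : ℝ))) *
        inner ℂ (translateFiber γ ψ (latticePoint γ m)) (translateFiber γ ψ (latticePoint γ n)) := by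
  rw [L2.inner_def, ← integral_mul_const]
  refine integral_congr_ae ?_
  filter_upwards [coeFn_zakLp γ ψ m, coeFn_zakLp γ ψ n] with k h1 h2
  rw [h1, h2, zakTerm_eq, zakTerm_eq, inner_shiftPhase, latticePoint_sub]

theorem norm_sq_zakLp (ψ : L2Space d) (n : Fin d → ℤ) :
    ‖zakLp γ ψ n‖ ^ 2 = volume.real (brillouin γ) *
      ‖translateFiber γ ψ (latticePoint γ n)‖ ^ 2 := by
  have h := inner_zakLp γ ψ n n
  rw [sub_self, latticePoint_zero, inner_self_eq_norm_sq_to_K, inner_self_eq_norm_sq_to_K] at h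
  simp only [inner_zero_left, ofReal_zero, mul_zero, Complex.exp_zero, integral_const,
    measureReal_restrict_apply_univ] at h
  simp only [real_smul, mul_one] at h
  apply ofReal_injective
  push_cast
  exact h

/-- The translated cells overlap only in null sets, so the sum is at most `‖ψ‖²`. -/
theorem summable_norm_sq_translateFiber (ψ : L2Space d) :
    Summable fun n => ‖translateFiber γ ψ (latticePoint γ n)‖ ^ 2 := by
  have h1 : ∀ n, ENNReal.ofReal (‖translateFiber γ ψ (latticePoint γ n)‖ ^ 2) =
      ∫⁻ x in (fun x => x - latticePoint γ n) ⁻¹' cell γ, ‖ψ x‖ₑ ^ 2 := by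
    intro n
    have hmp := (measurePreserving_sub_right (volume : Measure (Space d)) (latticePoint γ n))
    have e1 := hmp.setLIntegral_comp_preimage_emb
      (MeasurableEquiv.subRight (latticePoint γ n)).measurableEmbedding
      (fun y => ‖ψ (y + latticePoint γ n)‖ₑ ^ 2) (cell γ)
    simp only [sub_add_cancel] at e1
    rw [e1, ENNReal.ofReal_pow (norm_nonneg _), ofReal_norm, Lp.enorm_def,
      eLpNorm_congr_ae (coeFn_translateFiber γ ψ (latticePoint γ n)),
      eLpNorm_eq_lintegral_rpow_enorm_toReal (by norm_num) (by norm_num)]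
    rw [← ENNReal.rpow_natCast, ← ENNReal.rpow_mul]
    simp
  have h2 : ∑' n, ENNReal.ofReal (‖translateFiber γ ψ (latticePoint γ n)‖ ^ 2) ≠ ∞ := by
    simp only [h1]
    rw [← lintegral_iUnion₀]
    · refine ne_top_of_le_ne_top ?_ (setLIntegral_le_lintegral _ _)
      have := (Lp.memLp ψ).2
      rw [eLpNorm_lt_top_iff_lintegral_rpow_enorm_lt_top (by norm_num) (by norm_num)] at this
      simpa using this.ne
    · exact fun n => ((measurable_sub_const _) (measurableSet_cell _)).nullMeasurableSet
    · intro m n hmn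
      have hmn' : m - n ≠ 0 := sub_ne_zero.2 hmn
      have h3 := (measurePreserving_sub_right (volume : Measure (Space d))
        (latticePoint γ m)).quasiMeasurePreserving.preimage_null
          (volume_cell_inter_translate γ hmn')
      refine measure_mono_null ?_ h3
      rintro x ⟨hx1, hx2⟩
      refine ⟨hx1, ?_⟩
      have : x - latticePoint γ m + latticePoint γ (m - n) = x - latticePoint γ n := by
        rw [latticePoint_sub]; abel
      rw [this]
      exact hx2
  have h4 := ENNReal.summable_toReal h2
  refine h4.congr fun n => ?_
  rw [ENNReal.toReal_ofReal (by positivity)]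

theorem summable_of_pairwise_orthogonal {ι E : Type*} [NormedAddCommGroup E]
    [InnerProductSpace ℂ E] [CompleteSpace E] {f : ι → E}
    (hf : ∀ i j, i ≠ j → inner ℂ (f i) (f j) = 0) (hs : Summable fun i => ‖f i‖ ^ 2) :
    Summable f := by
  have hV : OrthogonalFamily ℂ (fun i => Submodule.span ℂ {f i})
      fun i => (Submodule.span ℂ {f i}).subtypeₗᵢ := by
    intro i j hij x y
    obtain ⟨a, ha⟩ := Submodule.mem_span_singleton.1 x.2
    obtain ⟨b, hb⟩ := Submodule.mem_span_singleton.1 y.2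
    change inner ℂ (x : E) (y : E) = 0
    rw [← ha, ← hb, inner_smul_left, inner_smul_right, hf i j hij, mul_zero, mul_zero]
  exact (hV.summable_iff_norm_sq_summable
    (fun i => ⟨f i, Submodule.mem_span_singleton_self _⟩)).2 hs

theorem summable_zakLp (ψ : L2Space d) : Summable (zakLp γ ψ) := by
  refine summable_of_pairwise_orthogonal (fun m n hmn => ?_) ?_
  · rw [inner_zakLp, integral_brillouin_exp γ (sub_ne_zero.2 hmn), zero_mul]
  · simp only [norm_sq_zakLp]
    exact (summable_norm_sq_translateFiber γ ψ).mul_left _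

theorem tendsto_eLpNorm_sub_sum {ι α E : Type*} [Countable ι] [MeasurableSpace α] {μ : Measure α}
    [NormedAddCommGroup E] {f : ι → α → E} {T : ι → Lp E 2 μ} (hT : ∀ i, T i =ᵐ[μ] f i)
    {S : Lp E 2 μ} (hS : HasSum T S) :
    Tendsto (fun s : Finset ι => eLpNorm (fun x => S x - ∑ i ∈ s, f i x) 2 μ) atTop (𝓝 0) := by
  have h1 : Tendsto (fun s : Finset ι => ‖S - ∑ i ∈ s, T i‖ₑ) atTop (𝓝 0) := by
    have h2 : Tendsto (fun s : Finset ι => S - ∑ i ∈ s, T i) atTop (𝓝 (S - S)) :=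
      tendsto_const_nhds.sub hS
    have h3 := h2.enorm
    rwa [sub_self, enorm_zero] at h3
  refine h1.congr fun s => ?_
  rw [Lp.enorm_def]
  refine eLpNorm_congr_ae ?_
  filter_upwards [Lp.coeFn_sub S (∑ i ∈ s, T i), Lp.coeFn_finsetSum s T, ae_all_iff.2 hT]
    with x e1 e2 e3
  rw [e1, Pi.sub_apply, e2]
  simp [e3]

/-- Every `ψ ∈ L²(ℝ^d)` has a Bloch-Floquet-Zak transform. -/
theorem exists_isZakTransform (ψ : L2Space d) : ∃ Ψ, IsZakTransform γ ψ Ψ :=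
  ⟨_, Lp.aestronglyMeasurable _,
    tendsto_eLpNorm_sub_sum (coeFn_zakLp γ ψ) (summable_zakLp γ ψ).hasSum⟩

theorem measurePreserving_neg_brillouin :
    MeasurePreserving (fun x : Space d => -x) (volume.restrict (brillouin γ))
      (volume.restrict (brillouin γ)) := measurePreserving_neg_cell _

theorem IsZakTransform.reflection {ψ : L2Space d} {Ψ : Space d → Fiber γ}
    (h : IsZakTransform γ ψ Ψ) :
    IsZakTransform γ (reflection d ψ) fun k => fiberReflection γ (Ψ (-k)) := by
  have hmp := measurePreserving_neg_brillouin γ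
  refine ⟨(fiberReflection γ).continuous.comp_aestronglyMeasurable
    (h.1.comp_measurePreserving hmp), ?_⟩
  -- Unconditional summation is insensitive to the reindexing `n ↦ -n`.
  have h1 : Tendsto (fun s : Finset (Fin d → ℤ) => s.map (Equiv.neg _).toEmbedding) atTop atTop :=
    tendsto_atTop_atTop_of_monotone (fun s t hst => Finset.map_subset_map.2 hst) fun s =>
      ⟨s.map (Equiv.neg _).toEmbedding, fun x hx => by simpa using hx⟩
  refine (h.2.comp h1).congr fun s => ?_
  have h2 : ∀ k, fiberReflection γ (Ψ (-k)) - ∑ n ∈ s, zakTerm γ (BlochFloquet.reflection d ψ) n k =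
      fiberReflection γ (Ψ (-k) -
        ∑ n ∈ s.map (Equiv.neg (Fin d → ℤ)).toEmbedding, zakTerm γ ψ n (-k)) := by
    intro k
    rw [map_sub, map_sum, Finset.sum_map]
    simp only [zakTerm_reflection]
    rfl
  simp only [h2, Function.comp]
  have h3 : AEStronglyMeasurable (fun k => Ψ k -
      ∑ n ∈ s.map (Equiv.neg (Fin d → ℤ)).toEmbedding, zakTerm γ ψ n k)
      (volume.restrict (brillouin γ)) :=
    h.1.sub (Continuous.aestronglyMeasurable
      (continuous_finsetSum _ fun n _ => continuous_zakTerm γ ψ n))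
  rw [← eLpNorm_comp_measurePreserving h3 hmp]
  refine eLpNorm_congr_norm_ae (Eventually.of_forall fun k => ?_)
  rw [norm_fiberReflection]
  rfl

/-- The extension by zero of an element of the fibre space. -/
def extendZero (u : Fiber γ) : L2Space d :=
  ((memLp_indicator_iff_restrict (measurableSet_cell (γ : Fin d → Space d))).2 (Lp.memLp u)).toLp _

theorem coeFn_extendZero (u : Fiber γ) : extendZero γ u =ᵐ[volume] (cell γ).indicator u :=
  MemLp.coeFn_toLp _

theorem zakTerm_extendZero_zero (u : Fiber γ) (k : Space d) :
    zakTerm γ (extendZero γ u) 0 k = phase γ k u := by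
  refine Lp.ext ?_
  filter_upwards [coeFn_zakTerm γ (extendZero γ u) 0 k, coeFn_phase γ k u,
    ae_restrict_of_ae (coeFn_extendZero γ u),
    ae_restrict_mem (measurableSet_cell (γ : Fin d → Space d))] with y h1 h2 h3 h4
  rw [h1, h2, latticePoint_zero, add_zero, h3, indicator_of_mem h4]

theorem zakTerm_extendZero_of_ne (u : Fiber γ) {n : Fin d → ℤ} (hn : n ≠ 0) (k : Space d) :
    zakTerm γ (extendZero γ u) n k = 0 := by
  have h0 : ∀ᵐ y ∂(volume.restrict (cell γ)),
      extendZero γ u (y + latticePoint γ n) = (cell γ).indicator u (y + latticePoint γ n) :=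
    ae_restrict_of_ae ((measurePreserving_add_right volume
      (latticePoint γ n)).quasiMeasurePreserving.ae (coeFn_extendZero γ u))
  have h00 : ∀ᵐ y : Space d, ¬ (y ∈ cell γ ∧ y + latticePoint γ n ∈ cell γ) := by
    rw [ae_iff]
    simpa using volume_cell_inter_translate γ hn
  refine Lp.ext ?_
  filter_upwards [coeFn_zakTerm γ (extendZero γ u) n k, h0, ae_restrict_of_ae h00,
    ae_restrict_mem (measurableSet_cell (γ : Fin d → Space d)),
    Lp.coeFn_zero ℂ 2 (volume.restrict (cell γ))] with y h1 h2 h3 h4 h5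
  rw [h1, h2, h5, indicator_of_notMem fun h => h3 ⟨h4, h⟩, mul_zero]
  rfl

/-- Only the term `n = 0` survives, which yields test vectors whose transform is explicit and
continuous in `k`. -/
theorem isZakTransform_extendZero (u : Fiber γ) :
    IsZakTransform γ (extendZero γ u) fun k => phase γ k u := by
  refine ⟨(continuous_shiftPhase γ 0 u).aestronglyMeasurable, ?_⟩
  refine tendsto_const_nhds.congr' ?_
  filter_upwards [eventually_ge_atTop {0}] with s hs
  have h0 : (0 : Fin d → ℤ) ∈ s := hs (Finset.mem_singleton_self _)
  have h1 : ∀ k, ∑ n ∈ s, zakTerm γ (extendZero γ u) n k = phase γ k u := by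
    intro k
    rw [Finset.sum_eq_single_of_mem 0 h0 fun n _ hn => zakTerm_extendZero_of_ne γ u hn k,
      zakTerm_extendZero_zero]
  simp [h1]

theorem IsZakTransform.add_smul {ψ φ : L2Space d} {Ψ Φ : Space d → Fiber γ}
    (hψ : IsZakTransform γ ψ Ψ) (hφ : IsZakTransform γ φ Φ) (c : ℂ) :
    IsZakTransform γ (ψ + c • φ) fun k => Ψ k + c • Φ k := by
  have hterm : ∀ n k, zakTerm γ (ψ + c • φ) n k = zakTerm γ ψ n k + c • zakTerm γ φ n k := by
    intro n k
    have h0 : ∀ᵐ y ∂(volume.restrict (cell γ)), (ψ + c • φ) (y + latticePoint γ n) =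
        ψ (y + latticePoint γ n) + c * φ (y + latticePoint γ n) := by
      refine ae_restrict_of_ae ((measurePreserving_add_right volume
        (latticePoint γ n)).quasiMeasurePreserving.ae
        (p := fun x => (ψ + c • φ) x = ψ x + c * φ x) ?_)
      filter_upwards [Lp.coeFn_add ψ (c • φ), Lp.coeFn_smul c φ] with x h1 h2
      rw [h1, Pi.add_apply, h2]
      rfl
    refine Lp.ext ?_
    filter_upwards [h0, coeFn_zakTerm γ (ψ + c • φ) n k, coeFn_zakTerm γ ψ n k,
      coeFn_zakTerm γ φ n k, Lp.coeFn_add (zakTerm γ ψ n k) (c • zakTerm γ φ n k),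
      Lp.coeFn_smul c (zakTerm γ φ n k)] with y h1 h2 h3 h4 h5 h6
    rw [h2, h1, h5, Pi.add_apply, h6, Pi.smul_apply, h3, h4, smul_eq_mul]
    ring
  refine ⟨hψ.1.add (hφ.1.const_smul c), ?_⟩
  have hlim : Tendsto (fun s : Finset (Fin d → ℤ) =>
      eLpNorm (fun k => Ψ k - ∑ n ∈ s, zakTerm γ ψ n k) 2 (volume.restrict (brillouin γ)) +
      ‖c‖ₑ * eLpNorm (fun k => Φ k - ∑ n ∈ s, zakTerm γ φ n k) 2 (volume.restrict (brillouin γ)))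
      atTop (𝓝 0) := by
    have := hψ.2.add (ENNReal.Tendsto.const_mul hφ.2 (Or.inr (enorm_ne_top (x := c))))
    simpa using this
  refine tendsto_of_tendsto_of_tendsto_of_le_of_le tendsto_const_nhds hlim
    (fun _ => zero_le) fun s => ?_
  have m1 : AEStronglyMeasurable (fun k => Ψ k - ∑ n ∈ s, zakTerm γ ψ n k)
      (volume.restrict (brillouin γ)) := hψ.1.sub (Continuous.aestronglyMeasurable
      (continuous_finsetSum _ fun n _ => continuous_zakTerm γ ψ n))
  have m2 : AEStronglyMeasurable (fun k => Φ k - ∑ n ∈ s, zakTerm γ φ n k)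
      (volume.restrict (brillouin γ)) := hφ.1.sub (Continuous.aestronglyMeasurable
      (continuous_finsetSum _ fun n _ => continuous_zakTerm γ φ n))
  rw [← eLpNorm_const_smul]
  refine le_trans (le_of_eq ?_) (eLpNorm_add_le m1 (m2.const_smul c) (by norm_num))
  congr 1
  funext k
  simp only [hterm, Finset.sum_add_distrib, ← Finset.smul_sum, Pi.add_apply, Pi.smul_apply]
  module

variable {γ}

/-! ### Reflection symmetry of the fibre operators -/

theorem neg_mem_brillouin {k : Space d} (hk : k ∈ brillouin γ) : -k ∈ brillouin γ := by
  have h := neg_preimage_cell (dualGen γ)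
  have : -k ∈ (fun x : Space d => -x) ⁻¹' brillouin γ := by simpa using hk
  rwa [brillouin, h] at this

theorem exists_mem_brillouin_add (γ : Module.Basis (Fin d) ℝ (Space d)) (k : Space d) :
    ∃ k₀ ∈ brillouin γ, ∃ n, k = k₀ + latticePoint (dualGen γ) n := by
  obtain ⟨n, hn⟩ := exists_sub_latticePoint_mem_cell (dualBasis γ) k
  rw [← brillouin_eq, coe_dualBasis] at hn
  exact ⟨_, hn, n, (sub_add_cancel _ _).symm⟩

namespace IsContinuouslyFibered

variable {H : L2Space d →ₗ.[ℂ] L2Space d} {h : Space d → Fiber γ →ₗ.[ℂ] Fiber γ}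

/-- With `φ` solving `(H - i)φ = extendZero u`, the transform of `φ` at `-k` is `res (-k)` of the
explicit source. Its reflection is `res k` of the reflected source, since `H` commutes with the
reflection. -/
theorem ae_resolvent_reflection (hfib : IsContinuouslyFibered γ H h) (hH : IsSelfAdjoint H)
    (hR : CommutesWithReflection H) {res : Space d → Fiber γ →L[ℂ] Fiber γ}
    (hres : ∀ k, IsResolvent (h k) I (res k)) (u : Fiber γ) :
    ∀ᵐ k ∂(volume.restrict (brillouin γ)),
      fiberReflection γ (res (-k) (phase γ (-k) u)) =
        res k (fiberReflection γ (phase γ (-k) u)) := by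
  obtain ⟨φ, hφ⟩ := exists_graph_sub_I hH (extendZero γ u)
  obtain ⟨Φ, hΦ⟩ := exists_isZakTransform γ φ
  have hΨ := (isZakTransform_extendZero γ u).add_smul γ hΦ I
  have h1 := (hfib.directIntegral _ _ _ _ hΦ hΨ).1 hφ
  have h2 := (hfib.directIntegral _ _ _ _ (hΦ.reflection γ) (hΨ.reflection γ)).1 (hR _ _ hφ)
  have h3 := (measurePreserving_neg_brillouin γ).quasiMeasurePreserving.ae h1
  filter_upwards [h2, h3] with k e2 e3
  have r2 := (hres k).2 _ _ e2
  have r3 := (hres (-k)).2 _ _ e3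
  rw [map_add, map_smul, add_sub_cancel_right] at r2
  rw [add_sub_cancel_right] at r3
  rw [r2, r3]

theorem resolvent_reflection (hfib : IsContinuouslyFibered γ H h) (hH : IsSelfAdjoint H)
    (hR : CommutesWithReflection H) {res : Space d → Fiber γ →L[ℂ] Fiber γ}
    (hcont : Continuous res) (hres : ∀ k, IsResolvent (h k) I (res k)) {k : Space d}
    (hk : k ∈ brillouin γ) (u : Fiber γ) :
    fiberReflection γ (res (-k) u) = res k (fiberReflection γ u) := by
  have hphase : ∀ w, Continuous fun q : Space d => phase γ (-q) w := fun w =>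
    (continuous_shiftPhase γ 0 w).comp continuous_neg
  have hsub : brillouin γ ⊆ closure (interior (brillouin γ)) := by
    rw [brillouin_eq]
    exact cell_subset_closure_interior _
  -- The exceptional null set depends on `w`, but both sides are continuous in `k`, so none remains.
  have key : ∀ w, fiberReflection γ (res (-k) (phase γ (-k) w)) =
      res k (fiberReflection γ (phase γ (-k) w)) := fun w =>
    Measure.eqOn_of_ae_eq (ae_resolvent_reflection hfib hH hR hres w)
      ((fiberReflection γ).continuous.comp
        ((hcont.comp continuous_neg).clm_apply (hphase w))).continuousOn
      (hcont.clm_apply ((fiberReflection γ).continuous.comp (hphase w))).continuousOn hsub hk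
  -- The phase is invertible at the fixed `k`, so every vector is reached.
  have := key (phase γ k u)
  rwa [phase_neg_phase] at this

/-- The fibre operators at `k` and `-k` are intertwined by the space reflection. -/
theorem reflection_mem_graph (hfib : IsContinuouslyFibered γ H h) (hH : IsSelfAdjoint H)
    (hR : CommutesWithReflection H) {k : Space d} {u v : Fiber γ} (huv : (u, v) ∈ (h k).graph) :
    (fiberReflection γ u, fiberReflection γ v) ∈ (h (-k)).graph := by
  obtain ⟨res, hcont, hres⟩ := hfib.continuous
  have key : ∀ k ∈ brillouin γ, ∀ u v, (u, v) ∈ (h k).graph →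
      (fiberReflection γ u, fiberReflection γ v) ∈ (h (-k)).graph := by
    intro k hk u v huv
    have h1 := (hres k).2 u v huv
    have h2 := resolvent_reflection hfib hH hR hcont hres (neg_mem_brillouin hk) (v - I • u)
    rw [neg_neg, h1] at h2
    have h3 := (hres (-k)).1 (fiberReflection γ (v - I • u))
    rw [← h2, map_sub, map_smul, sub_add_cancel] at h3
    exact h3
  -- Shift to the zone, reflect there and shift back. Reflection inverts the phase, so the two
  -- phases cancel.
  obtain ⟨k₀, hk₀, n, rfl⟩ := exists_mem_brillouin_add γ k
  have h1 := hfib.equivariant _ (-n) _ _ huv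
  rw [latticePoint_neg, add_neg_cancel_right] at h1
  have h2 := hfib.equivariant _ (-n) _ _ (key k₀ hk₀ _ _ h1)
  rw [latticePoint_neg, fiberReflection_phase, fiberReflection_phase, neg_neg, phase_neg_phase,
    phase_neg_phase, ← neg_add] at h2
  exact h2

theorem reflection_mem_graph_iff (hfib : IsContinuouslyFibered γ H h) (hH : IsSelfAdjoint H)
    (hR : CommutesWithReflection H) {k : Space d} {u v : Fiber γ} :
    (fiberReflection γ u, fiberReflection γ v) ∈ (h (-k)).graph ↔ (u, v) ∈ (h k).graph := by
  refine ⟨fun huv => ?_, reflection_mem_graph hfib hH hR⟩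
  have := reflection_mem_graph hfib hH hR huv
  rwa [fiberReflection_fiberReflection, fiberReflection_fiberReflection, neg_neg] at this

/-! ### Reflection symmetry of the projections -/

theorem spectralProjection_reflection (hfib : IsContinuouslyFibered γ H h) (hH : IsSelfAdjoint H)
    (hR : CommutesWithReflection H) {E : ℝ} {P : Space d → Fiber γ →L[ℂ] Fiber γ}
    (hP : ∀ k, IsSpectralProjection (h k) (Iio E) (P k)) (k : Space d) :
    P k = fiberReflection γ * P (-k) * fiberReflection γ := by
  obtain ⟨F, hF, hPF⟩ := hP k
  obtain ⟨G, hG, hPG⟩ := hP (-k)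
  have h1 := hG.mul_map_Iio_eq hF (hfib.selfAdjoint (-k)) (hfib.selfAdjoint k)
    (isSelfAdjoint_fiberReflection γ)
    (fun u v huv => by simpa using reflection_mem_graph hfib hH hR huv)
    (fun u v huv => reflection_mem_graph hfib hH hR huv) E
  rw [hPG, h1, mul_assoc, fiberReflection_mul_self, mul_one, hPF]

/-- By reflection `e(-k)` is an eigenvalue at `k`, so it equals `e(k)` or differs from it by at
least the uniform gap. The set of equality is thus clopen, and it contains `0`. -/
theorem isolatedBand_even (hfib : IsContinuouslyFibered γ H h) (hH : IsSelfAdjoint H)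
    (hR : CommutesWithReflection H) {e : Space d → ℝ} (he : IsIsolatedBand h e) (k : Space d) :
    e (-k) = e k := by
  obtain ⟨g, hg, hgap⟩ := he.gap
  have hiff : ∀ k, e (-k) = e k ↔ |e (-k) - e k| < g := by
    intro k
    refine ⟨fun h => by simpa [h] using hg, fun hlt => ?_⟩
    by_contra hne
    obtain ⟨u, hu, huv⟩ := he.eigenvalue (-k)
    have h1 := reflection_mem_graph hfib hH hR huv
    rw [neg_neg, map_smul] at h1
    have h2 : fiberReflection γ u ≠ 0 := fun h0 => hu (by
      rw [← fiberReflection_fiberReflection γ u, h0, map_zero])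
    exact absurd (hgap k _ (mem_opSpectrum_of_eigenvector h2 h1) hne) (not_le.2 hlt)
  have hc := he.continuous
  have hclopen : IsClopen {k | e (-k) = e k} := by
    refine ⟨isClosed_eq (by fun_prop) hc, ?_⟩
    simp only [hiff]
    exact isOpen_lt (by fun_prop) continuous_const
  have huniv := hclopen.eq_univ ⟨0, by simp⟩
  have : k ∈ {k | e (-k) = e k} := huniv ▸ mem_univ k
  exact this

theorem eigenprojection_reflection (hfib : IsContinuouslyFibered γ H h) (hH : IsSelfAdjoint H)
    (hR : CommutesWithReflection H) {e : Space d → ℝ} (he : IsIsolatedBand h e)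
    {P : Space d → Fiber γ →L[ℂ] Fiber γ} (hP : ∀ k, IsEigenprojection (h k) (e k) (P k))
    (k : Space d) : P k = fiberReflection γ * P (-k) * fiberReflection γ := by
  refine isStarProjection_eq_of_forall (hP k).1 (isStarProjection_conj (hP (-k)).1
    (isSelfAdjoint_fiberReflection γ) (fiberReflection_mul_self γ)) fun u => ?_
  rw [(hP k).2, ← reflection_mem_graph_iff hfib hH hR, map_smul, ← isolatedBand_even hfib hH hR he,
    ← (hP (-k)).2]
  constructor
  · intro h1
    change fiberReflection γ (P (-k) (fiberReflection γ u)) = u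
    rw [h1, fiberReflection_fiberReflection]
  · intro h1
    have h2 := congrArg (fiberReflection γ) h1
    change fiberReflection γ (fiberReflection γ (P (-k) (fiberReflection γ u))) = _ at h2
    rwa [fiberReflection_fiberReflection] at h2

end IsContinuouslyFibered

/-! ### The piezocurvature is odd -/

section Involution

variable {V : Type*} [NormedAddCommGroup V] [NormedSpace ℝ V] {L : V →+ V} (hLc : Continuous L)
  (hL : ∀ x, L (L x) = x)
include hLc hL

/-- As `L` is invertible, `f` and `L ∘ f` are differentiable together; otherwise both derivatives
are `0`. -/
theorem derivWithin_involution {J : Set ℝ} {t : ℝ} (hJ : UniqueDiffWithinAt ℝ J t) (f : ℝ → V) :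
    derivWithin (fun s => L (f s)) J t = L (derivWithin f J t) := by
  let M : V →L[ℝ] V := L.toRealLinearMap hLc
  by_cases hf : DifferentiableWithinAt ℝ f J t
  · exact (M.hasFDerivAt.comp_hasDerivWithinAt t hf.hasDerivWithinAt).derivWithin hJ
  · have hf' : ¬ DifferentiableWithinAt ℝ (fun s => L (f s)) J t := by
      intro h1
      have h2 := M.differentiableAt.comp_differentiableWithinAt t h1
      have h3 : (M ∘ fun s => L (f s)) = f := funext fun s => hL (f s)
      rw [h3] at h2
      exact hf h2
    rw [derivWithin_zero_of_not_differentiableWithinAt hf,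
      derivWithin_zero_of_not_differentiableWithinAt hf', map_zero]

theorem lineDeriv_neg_of_involution {E : Type*} [AddCommGroup E] [Module ℝ E] {f : E → V}
    (hf : ∀ q, f q = L (f (-q))) (k v : E) :
    lineDeriv ℝ f (-k) v = -L (lineDeriv ℝ f k v) := by
  have e1 : (fun s : ℝ => f (-k + s • v)) = fun s : ℝ => L (f (k + (-s) • v)) := by
    funext s
    rw [hf, neg_add, neg_neg, neg_smul]
  have e2 := derivWithin_involution hLc hL uniqueDiffWithinAt_univ (t := 0)
    (fun s : ℝ => f (k + s • v))
  have e3 := deriv_comp_neg (fun s : ℝ => L (f (k + s • v))) 0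
  rw [derivWithin_univ, derivWithin_univ] at e2
  rw [neg_zero, e2] at e3
  rw [lineDeriv, e1, e3, lineDeriv]

end Involution

/-- Conjugation by the space reflection. -/
def reflectionConj (γ : Module.Basis (Fin d) ℝ (Space d)) :
    (Fiber γ →L[ℂ] Fiber γ) →+ (Fiber γ →L[ℂ] Fiber γ) :=
  (AddMonoidHom.mulRight (fiberReflection γ)).comp (AddMonoidHom.mulLeft (fiberReflection γ))

theorem reflectionConj_apply (A : Fiber γ →L[ℂ] Fiber γ) :
    reflectionConj γ A = fiberReflection γ * A * fiberReflection γ := rfl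

theorem continuous_reflectionConj : Continuous (reflectionConj γ) :=
  (continuous_const.mul continuous_id).mul continuous_const

theorem reflectionConj_reflectionConj (A : Fiber γ →L[ℂ] Fiber γ) :
    reflectionConj γ (reflectionConj γ A) = A :=
  conj_conj_of_mul_self (fiberReflection_mul_self γ) A

theorem trace_commutator_reflectionConj (A B C : Fiber γ →L[ℂ] Fiber γ) :
    trace (reflectionConj γ A * (reflectionConj γ B * -reflectionConj γ C -
      -reflectionConj γ C * reflectionConj γ B)) = -trace (A * (B * C - C * B)) :=
  trace_commutator_conj (isSelfAdjoint_fiberReflection γ) (fiberReflection_mul_self γ) A B C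

theorem derivWithin_reflectionConj {J : Set ℝ} {t : ℝ} (hJ : UniqueDiffWithinAt ℝ J t)
    (f : ℝ → Fiber γ →L[ℂ] Fiber γ) :
    derivWithin (fun s => reflectionConj γ (f s)) J t = reflectionConj γ (derivWithin f J t) :=
  derivWithin_involution continuous_reflectionConj reflectionConj_reflectionConj hJ f

theorem lineDeriv_neg_reflectionConj {f : Space d → Fiber γ →L[ℂ] Fiber γ}
    (hf : ∀ q, f q = reflectionConj γ (f (-q))) (k v : Space d) :
    lineDeriv ℝ f (-k) v = -reflectionConj γ (lineDeriv ℝ f k v) :=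
  lineDeriv_neg_of_involution continuous_reflectionConj reflectionConj_reflectionConj hf k v

theorem piezocurvature_apply (J : Set ℝ) (P : Space d → ℝ → Fiber γ →L[ℂ] Fiber γ) (k : Space d)
    (t : ℝ) (j : Fin d) {A B : Fiber γ →L[ℂ] Fiber γ} (hA : derivWithin (fun s => P k s) J t = A)
    (hB : lineDeriv ℝ (fun q => P q t) k (EuclideanSpace.single j 1) = B) :
    piezocurvature J P k t j = -I * trace (P k t * (A * B - B * A)) := by
  subst hA hB
  rfl

set_option maxHeartbeats 800000 in
theorem piezocurvature_neg {J : Set ℝ} (hJ : UniqueDiffOn ℝ J)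
    {P : Space d → ℝ → Fiber γ →L[ℂ] Fiber γ}
    (hP : ∀ t ∈ J, ∀ k, P k t = fiberReflection γ * P (-k) t * fiberReflection γ)
    {t : ℝ} (ht : t ∈ J) (k : Space d) :
    piezocurvature J P (-k) t = -piezocurvature J P k t := by
  have hP' : ∀ t ∈ J, P (-k) t = reflectionConj γ (P k t) := fun t ht => by
    rw [hP t ht (-k), neg_neg, reflectionConj_apply]
  funext j
  have h1 := (derivWithin_congr hP' (hP' t ht)).trans
    (derivWithin_reflectionConj (hJ t ht) fun s => P k s)
  have h2 := lineDeriv_neg_reflectionConj (f := fun q => P q t) (hP t ht) k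
    (EuclideanSpace.single j 1)
  rw [Pi.neg_apply, piezocurvature_apply J P (-k) t j h1 h2, piezocurvature_apply J P k t j rfl rfl,
    hP' t ht, trace_commutator_reflectionConj, mul_neg]

/-- Substituting `k ↦ -k` shows the integral equals its own negative, whether or not the integrand
is integrable. -/
theorem piezoCurrent_eq_zero_of_odd {J : Set ℝ} {P : Space d → ℝ → Fiber γ →L[ℂ] Fiber γ} {t : ℝ}
    (hodd : ∀ k, piezocurvature J P (-k) t = -piezocurvature J P k t) :
    piezoCurrent J P t = 0 := by
  have h1 := (measurePreserving_neg_brillouin γ).integral_comp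
    (MeasurableEquiv.neg (Space d)).measurableEmbedding (fun k => piezocurvature J P k t)
  simp only [hodd] at h1
  rw [integral_neg, neg_eq_self] at h1
  rw [piezoCurrent, h1, smul_zero]

end

end BlochFloquet

open BlochFloquet

theorem mainTheorem4 {d : ℕ} (γ : Module.Basis (Fin d) ℝ (Space d))
    (J : Set ℝ) (hJ : UniqueDiffOn ℝ J)
    (H : ℝ → L2Space d →ₗ.[ℂ] L2Space d)
    (h : Space d → ℝ → Fiber γ →ₗ.[ℂ] Fiber γ)
    (hH : ∀ t ∈ J, IsSelfAdjoint (H t))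
    (hR : ∀ t ∈ J, CommutesWithReflection (H t))
    (hfib : ∀ t ∈ J, IsContinuouslyFibered γ (H t) (fun k => h k t))
    (P : Space d → ℝ → Fiber γ →L[ℂ] Fiber γ)
    (hP : (∃ E : ℝ → ℝ, ∀ t ∈ J, ∀ k, IsSpectralProjection (h k t) (Set.Iio (E t)) (P k t)) ∨
      (∃ e : Space d → ℝ → ℝ, ∀ t ∈ J, IsIsolatedBand (fun k => h k t) (fun k => e k t) ∧
        ∀ k, IsEigenprojection (h k t) (e k t) (P k t))) :
    (∀ t ∈ J, ∀ k, P k t = fiberReflection γ * P (-k) t * fiberReflection γ) ∧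
    (∀ t ∈ J, ∀ k, piezocurvature J P (-k) t = -piezocurvature J P k t) ∧
    (∀ t ∈ J, piezoCurrent J P t = 0) := by
  have hsymm : ∀ t ∈ J, ∀ k, P k t = fiberReflection γ * P (-k) t * fiberReflection γ := by
    intro t ht
    rcases hP with ⟨E, hE⟩ | ⟨e, he⟩
    · exact (hfib t ht).spectralProjection_reflection (P := fun k => P k t) (hH t ht) (hR t ht)
        (hE t ht)
    · exact (hfib t ht).eigenprojection_reflection (P := fun k => P k t) (hH t ht) (hR t ht)
        (he t ht).1 (he t ht).2
  have hodd : ∀ t ∈ J, ∀ k, piezocurvature J P (-k) t = -piezocurvature J P k t :=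
    fun t ht k => piezocurvature_neg hJ hsymm ht k
  exact ⟨hsymm, hodd, fun t ht => piezoCurrent_eq_zero_of_odd (hodd t ht)⟩
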